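/- For integers $0\le a\le N$ let $\mathbb{R}^N_a$ be $\mathbb{R}^N$ with the scalar product $\langle x,y\rangle=-\sum_{j\le a}x_jy_j+\sum_{j>a}x_jy_j$. For $c>0$ put $\mathbb{S}^N_a(c)=\{x\in\mathbb{R}^{N+1}_a:\langle x,x\rangle=1/c\}$ and $\mathbb{H}^N_a(-c)=\{x\in\mathbb{R}^{N+1}_{a+1}:\langle x,x\rangle=-1/c\}$, with the induced semi-Riemannian metrics. Let $k\ge 0$ and, for $l=1,\dots,k$, let $f_l:M_l\to\mathbb{R}^{n_l}$ be a smooth isometric immersion of a smooth Riemannian manifold $(M_l,g_l)$ (without boundary) into Euclidean space. Let $I\subseteq\mathbb{R}$ be an open interval and let $\rho,\eta_1,\dots,\eta_k:I\to(0,\infty)$ be smooth functions. Let $M=I\times M_1\times\dots\times M_k$ carry the warped product metric $$g=\rho(t)^2\,dt^2+\eta_1(t)^2g_1+\dots+\eta_k(t)^2g_k .$$ Put $n=n_1+\dots+n_k$, and let $a\in\{0,\dots,n\}$ and $c>0$. Then the following hold. 1. $(M,g)$ admits smooth isometric immersions into each of $\mathbb{R}^{4n+1-2a}_a$, $\mathbb{S}^{4n+1-2a}_a(c)$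 and $\mathbb{H}^{4n+1-a}_a(-c)$. 2. If each $f_l$ is an embedding (that is, also a homeomorphism onto its image), then $(M,g)$ admits smooth isometric embeddings into each of $\mathbb{R}^{8n+1-6a}_a$, $\mathbb{S}^{8n+3-6a}_a(c)$ and $\mathbb{H}^{8n+1-5a}_a(-c)$. Moreover, when $a=0$, the maps into $\mathbb{H}^{N}_0(-c)$ in 1 and 2 can be chosen with values in the sheet $\{x_1>0\}$, that is, in the hyperbolic space $\mathbb{H}^N(-c)$. -/

import Mathlib

open scoped Manifold ContDiff

noncomputable section

/-- The scalar product `- x₁ y₁ - … - xₐ yₐ + xₐ₊₁ yₐ₊₁ + … + x_N y_N` of the semi-Euclidean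
space `ℝ^N_a`. -/
def semiInner (a : ℕ) {N : ℕ} (x y : EuclideanSpace ℝ (Fin N)) : ℝ :=
  ∑ i : Fin N, (if i.val < a then (-1 : ℝ) else 1) * (x i * y i)

/-- The quadric `𝕊^N_a(c) = {x ∈ ℝ^{N+1}_a | ⟨x, x⟩ = 1 / c}`. -/
def pseudoSphere (N a : ℕ) (c : ℝ) : Set (EuclideanSpace ℝ (Fin (N + 1))) :=
  {x | semiInner a x x = 1 / c}

/-- The quadric `ℍ^N_a(-c) = {x ∈ ℝ^{N+1}_{a+1} | ⟨x, x⟩ = -1 / c}`. -/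
def pseudoHyperbolic (N a : ℕ) (c : ℝ) : Set (EuclideanSpace ℝ (Fin (N + 1))) :=
  {x | semiInner (a + 1) x x = -(1 / c)}

/-- A smooth isometric immersion of a manifold `M`, with a family `g` of scalar products on its
tangent spaces, into `ℝ^N` with the constant scalar product `q`: a smooth map whose differential is
injective at every point and which pulls `q` back to `g`. -/
structure IsIsometricImmersion {E H M : Type*} [NormedAddCommGroup E] [NormedSpace ℝ E]
    [TopologicalSpace H] (I : ModelWithCorners ℝ E H) [TopologicalSpace M] [ChartedSpace H M]
    (g : ∀ p : M, TangentSpace I p → TangentSpace I p → ℝ) {N : ℕ}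
    (q : EuclideanSpace ℝ (Fin N) → EuclideanSpace ℝ (Fin N) → ℝ)
    (F : M → EuclideanSpace ℝ (Fin N)) : Prop where
  contMDiff : ContMDiff I (𝓡 N) ∞ F
  injective_mfderiv : ∀ p, Function.Injective (mfderiv I (𝓡 N) F p)
  pullback_eq : ∀ (p : M) (v w : TangentSpace I p),
    q (mfderiv I (𝓡 N) F p v) (mfderiv I (𝓡 N) F p w) = g p v w

/-- A smooth isometric immersion into a hypersurface `Q` of `ℝ^N`, where the tangent spaces of `Q`
carry the restriction of the scalar product `q`. As `Q` has the structure induced by the ambient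
space, this is a map to `Q` which is a smooth isometric immersion as a map to `ℝ^N`. -/
def IsIsometricImmersionInto {E H M : Type*} [NormedAddCommGroup E] [NormedSpace ℝ E]
    [TopologicalSpace H] (I : ModelWithCorners ℝ E H) [TopologicalSpace M] [ChartedSpace H M]
    (g : ∀ p : M, TangentSpace I p → TangentSpace I p → ℝ) {N : ℕ}
    (q : EuclideanSpace ℝ (Fin N) → EuclideanSpace ℝ (Fin N) → ℝ)
    (Q : Set (EuclideanSpace ℝ (Fin N))) (F : M → Q) : Prop :=
  IsIsometricImmersion I g q (fun p => (F p : EuclideanSpace ℝ (Fin N)))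

/-- The model with corners (without boundary) of a product `J × ∏ l, M l`, where `J ⊆ ℝ` is open
and `M l` has dimension `m l`. -/
abbrev warpedModel {k : ℕ} (m : Fin k → ℕ) :
    ModelWithCorners ℝ (ℝ × ∀ l, EuclideanSpace ℝ (Fin (m l)))
      (ModelProd ℝ (ModelPi fun l => EuclideanSpace ℝ (Fin (m l)))) :=
  𝓘(ℝ, ℝ).prod (ModelWithCorners.pi fun l => 𝓡 (m l))

section Warped

variable {k : ℕ} {m : Fin k → ℕ} {M : Fin k → Type*} [∀ l, TopologicalSpace (M l)]
    [∀ l, ChartedSpace (EuclideanSpace ℝ (Fin (m l))) (M l)] {J : TopologicalSpace.Opens ℝ}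

/-- The differential `dt` of the coordinate `t` on `J × ∏ l, M l`. -/
def warpedDt (p : J × ∀ l, M l) (v : TangentSpace (warpedModel m) p) : ℝ :=
  mfderiv (warpedModel m) 𝓘(ℝ, ℝ) (fun x : J × ∀ l, M l => (x.1 : ℝ)) p v

/-- The differential of the projection of `J × ∏ l, M l` to `M l`. -/
def warpedDproj (l : Fin k) (p : J × ∀ l, M l) (v : TangentSpace (warpedModel m) p) :
    TangentSpace (𝓡 (m l)) (p.2 l) :=
  mfderiv (warpedModel m) (𝓡 (m l)) (fun x : J × ∀ l, M l => x.2 l) p v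

/-- The projection `(t, u) ↦ u l` of the model space. -/
def warpedProjL (m : Fin k → ℕ) (l : Fin k) :
    (ℝ × ∀ l, EuclideanSpace ℝ (Fin (m l))) →L[ℝ] EuclideanSpace ℝ (Fin (m l)) :=
  (ContinuousLinearMap.proj (R := ℝ) (φ := fun l => EuclideanSpace ℝ (Fin (m l))) l).comp
    (ContinuousLinearMap.snd ℝ ℝ _)

theorem hasMFDerivAt_warpedProj (l : Fin k) (p : J × ∀ l, M l) :
    HasMFDerivAt (warpedModel m) (𝓡 (m l)) (fun x : J × ∀ l, M l => x.2 l) p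
      (warpedProjL m l) := by
  refine ⟨by fun_prop, ?_⟩
  refine (warpedProjL m l).hasFDerivWithinAt.congr_of_eventuallyEq ?_ ?_
  · filter_upwards [extChartAt_target_mem_nhdsWithin (I := warpedModel m) p] with z hz
    have h2 : z.2 l ∈ (extChartAt (𝓡 (m l)) (p.2 l)).target := by
      simp only [extChartAt_prod, PartialEquiv.prod_target] at hz
      have h3 := hz.2
      simp [extChartAt, ModelWithCorners.pi, piChartedSpace_chartAt] at h3
      simp [extChartAt]
      exact h3 l trivial
    exact (extChartAt (𝓡 (m l)) (p.2 l)).right_inv h2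
  · exact (extChartAt (𝓡 (m l)) (p.2 l)).right_inv
      ((extChartAt (𝓡 (m l)) (p.2 l)).map_source (mem_extChartAt_source _))

theorem hasMFDerivAt_warpedTime (p : J × ∀ l, M l) :
    HasMFDerivAt (warpedModel m) 𝓘(ℝ, ℝ) (fun x : J × ∀ l, M l => (x.1 : ℝ)) p
      (ContinuousLinearMap.fst ℝ ℝ (∀ l, EuclideanSpace ℝ (Fin (m l)))) := by
  refine ⟨by fun_prop, ?_⟩
  refine (ContinuousLinearMap.fst ℝ ℝ
    (∀ l, EuclideanSpace ℝ (Fin (m l)))).hasFDerivWithinAt.congr_of_eventuallyEq ?_ ?_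
  · filter_upwards [extChartAt_target_mem_nhdsWithin (I := warpedModel m) p] with z hz
    simp only [extChartAt_prod, PartialEquiv.prod_target] at hz
    exact (extChartAt 𝓘(ℝ, ℝ) p.1).right_inv hz.1
  · exact (extChartAt 𝓘(ℝ, ℝ) p.1).right_inv
      ((extChartAt 𝓘(ℝ, ℝ) p.1).map_source (mem_extChartAt_source _))

/-- `dt` is the first component of a tangent vector. -/
theorem warpedDt_eq (p : J × ∀ l, M l) (v : TangentSpace (warpedModel m) p) :
    warpedDt p v = v.1 := by
  rw [warpedDt, (hasMFDerivAt_warpedTime p).mfderiv]; rfl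

/-- The differential of the projection to `M l` is the component of a tangent vector at `l`. -/
theorem warpedDproj_eq (l : Fin k) (p : J × ∀ l, M l) (v : TangentSpace (warpedModel m) p) :
    warpedDproj l p v = v.2 l := by
  rw [warpedDproj, (hasMFDerivAt_warpedProj l p).mfderiv]; rfl

/-- The warped product metric `ρ(t)² dt² + ∑ l, η l (t)² π_l^* (g l)` on `J × ∏ l, M l`, where
`π_l` is the projection to `M l`. -/
def warpedMetric [∀ l, IsManifold (𝓡 (m l)) ∞ (M l)]
    (g : ∀ l, Bundle.ContMDiffRiemannianMetric (𝓡 (m l)) ∞ (EuclideanSpace ℝ (Fin (m l)))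
      (fun x : M l => TangentSpace (𝓡 (m l)) x))
    (J : TopologicalSpace.Opens ℝ) (ρ : ℝ → ℝ) (η : Fin k → ℝ → ℝ)
    (p : J × ∀ l, M l) (v w : TangentSpace (warpedModel m) p) : ℝ :=
  ρ p.1 ^ 2 * (warpedDt p v * warpedDt p w) +
    ∑ l, η l p.1 ^ 2 * (g l).inner (p.2 l) (warpedDproj l p v) (warpedDproj l p w)

end Warped

end

/-! The map `(t, p) ↦ (t, f(p))` pulls `ρ² dt² + ∑ η_i² du_i²` on `J × ℝ^n` back to the warped
metric, each coordinate `u_i` carrying the warping function of its factor. So it suffices to map `J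
× ℝ^n`, and this is done coordinate by coordinate, with blocks of the form `A(t) γ(L)`, where `γ`
has unit speed on `⟨x, x⟩ = σ`. Such a block pulls the scalar product back to `σ dA² + A² dL²`,
without cross terms.

For `a` of the coordinates the block is `η (cosh u, sinh u)`. It gives exactly `η² du²`, at the
price of `-η'² dt²` and of the value `-η²` of the quadratic form. For pseudohyperbolic targets a
further coordinate `η` cancels both.

For the other `n - a` coordinates the signs are all positive and `γ` is spherical. Here `η²` is
split as `(A₀ μ₀)² + (A₁ μ₁)²`, with step functions `μ_b` that jump only where `A_b` vanishes. The
block `A_b γ(μ_b u)` is then smooth and gives `A_b'² dt² + (A_b μ_b)² du²`; large `μ_b` make `A_b`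
and `A_b'` as small as desired (`exists_twist_decomposition`).

A last block depending on `t` alone supplies what is missing of `ρ² dt²`. On a quadric it is `r(t)
γ(Θ(t))`: the radius `r` is forced by the equation of the quadric and `Θ'` by the metric
(`exists_radius_angle`). The required inequality holds when the errors are small; for pseudospheres
it rests on Cauchy–Schwarz.

A circle as spherical curve gives immersions. For embeddings it is replaced by a line of unit speed
that is embedded in a sphere: then `t` can be read off continuously from the last block, and each
`u_i` from its own block. -/

section WarpedImmersions

open Set Filter Topology

/-! ### Unit-speed curves on quadrics -/

/-- A curve `γ` in the space of functions on `K`, with the scalar product of signs `ε`, that has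
unit speed and lies on the quadric `⟨x, x⟩ = σ`. -/
structure IsUnitCurve {K : Type*} [Fintype K] (ε : K → ℝ) (σ : ℝ) (γ : K → ℝ → ℝ) : Prop where
  contDiff : ∀ k, ContDiff ℝ ∞ (γ k)
  norm : ∀ θ, ∑ k, ε k * (γ k θ * γ k θ) = σ
  speed : ∀ θ, ∑ k, ε k * (deriv (γ k) θ * deriv (γ k) θ) = 1

namespace IsUnitCurve

variable {K : Type*} [Fintype K] {ε : K → ℝ} {σ : ℝ} {γ : K → ℝ → ℝ}

theorem hasDerivAt (hγ : IsUnitCurve ε σ γ) (k : K) (θ : ℝ) :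
    HasDerivAt (γ k) (deriv (γ k) θ) θ :=
  ((hγ.contDiff k).differentiable (by simp)).differentiableAt.hasDerivAt

theorem orthogonal (hγ : IsUnitCurve ε σ γ) (θ : ℝ) :
    ∑ k, ε k * (γ k θ * deriv (γ k) θ) = 0 := by
  have h1 : HasDerivAt (fun θ => ∑ k, ε k * (γ k θ * γ k θ))
      (∑ k, ε k * (deriv (γ k) θ * γ k θ + γ k θ * deriv (γ k) θ)) θ :=
    HasDerivAt.fun_sum fun k _ => ((hγ.hasDerivAt k θ).mul (hγ.hasDerivAt k θ)).const_mul _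
  have h2 : (fun θ => ∑ k, ε k * (γ k θ * γ k θ)) = fun _ => σ := funext hγ.norm
  rw [h2] at h1
  have h3 := h1.unique (hasDerivAt_const θ σ)
  have h4 : ∑ k, ε k * (deriv (γ k) θ * γ k θ + γ k θ * deriv (γ k) θ) =
      2 * ∑ k, ε k * (γ k θ * deriv (γ k) θ) := by
    rw [Finset.mul_sum]
    exact Finset.sum_congr rfl fun k _ => by ring
  linarith

/-- The pullback of the scalar product under `x ↦ A(t) γ(L(x))`. -/
theorem pullback {E : Type*} [NormedAddCommGroup E] [NormedSpace ℝ E]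
    (hγ : IsUnitCurve ε σ γ) {A L : E → ℝ} {A' L' : E →L[ℝ] ℝ} {x : E}
    (hA : HasFDerivAt A A' x) (hL : HasFDerivAt L L' x) {Φ : K → E → ℝ}
    (hΦ : ∀ k, Φ k =ᶠ[𝓝 x] fun y => A y * γ k (L y)) (v w : E) :
    ∑ k, ε k * (fderiv ℝ (Φ k) x v * fderiv ℝ (Φ k) x w) =
      σ * (A' v * A' w) + A x ^ 2 * (L' v * L' w) := by
  have h1 : ∀ k v, fderiv ℝ (Φ k) x v =
      A' v * γ k (L x) + A x * L' v * deriv (γ k) (L x) := by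
    intro k v
    have h2 : HasFDerivAt (fun y => A y * γ k (L y)) _ x :=
      hA.mul ((hγ.hasDerivAt k (L x)).comp_hasFDerivAt x hL)
    rw [((h2.congr_of_eventuallyEq (hΦ k))).fderiv]
    simp
    ring
  -- The three groups are norm, speed and mixed products; the mixed ones, which carry the cross
  -- terms, sum to zero by orthogonality.
  have h3 : ∀ k, ε k * (fderiv ℝ (Φ k) x v * fderiv ℝ (Φ k) x w) =
      (A' v * A' w) * (ε k * (γ k (L x) * γ k (L x))) +
      A x ^ 2 * (L' v * L' w) * (ε k * (deriv (γ k) (L x) * deriv (γ k) (L x))) +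
      A x * (A' v * L' w + A' w * L' v) * (ε k * (γ k (L x) * deriv (γ k) (L x))) := by
    intro k
    rw [h1, h1]
    ring
  simp_rw [h3]
  rw [Finset.sum_add_distrib, Finset.sum_add_distrib, ← Finset.mul_sum, ← Finset.mul_sum,
    ← Finset.mul_sum, hγ.norm, hγ.speed, hγ.orthogonal]
  ring

end IsUnitCurve

/-! ### Blocks and their direct sums -/

/-- Functions `Φ k` of `(t, u)`, where `t ∈ J`, that are the coordinates of a map to the space of
functions on `K` with the scalar product of signs `ε`, such that the pullback of the scalar product
is `h(t) dt² + ∑ j, c j (t) (du j)²` and the value of the quadratic form is `s(t)`. -/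
structure IsWarpedBlock {ι K : Type*} [Fintype ι] [Fintype K] (J : Set ℝ) (ε : K → ℝ)
    (Φ : K → ℝ × (ι → ℝ) → ℝ) (h s : ℝ → ℝ) (c : ι → ℝ → ℝ) : Prop where
  contDiffOn : ∀ k, ContDiffOn ℝ ∞ (Φ k) (J ×ˢ univ)
  pullback : ∀ x : ℝ × (ι → ℝ), x.1 ∈ J → ∀ v w,
    ∑ k, ε k * (fderiv ℝ (Φ k) x v * fderiv ℝ (Φ k) x w) =
      h x.1 * (v.1 * w.1) + ∑ j, c j x.1 * (v.2 j * w.2 j)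
  norm : ∀ x : ℝ × (ι → ℝ), x.1 ∈ J → ∑ k, ε k * (Φ k x * Φ k x) = s x.1
  contDiffOn_h : ContDiffOn ℝ ∞ h J
  contDiffOn_s : ContDiffOn ℝ ∞ s J

namespace IsWarpedBlock

variable {ι K : Type*} [Fintype ι] [Fintype K] {J : Set ℝ} {ε : K → ℝ}
  {Φ : K → ℝ × (ι → ℝ) → ℝ} {h s : ℝ → ℝ} {c : ι → ℝ → ℝ}

theorem congr (hΦ : IsWarpedBlock J ε Φ h s c) {h' s' : ℝ → ℝ} {c' : ι → ℝ → ℝ}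
    (hh : ∀ t ∈ J, h' t = h t) (hs : ∀ t ∈ J, s' t = s t) (hc : ∀ t ∈ J, ∀ j, c' j t = c j t) :
    IsWarpedBlock J ε Φ h' s' c' where
  contDiffOn := hΦ.contDiffOn
  pullback x hx v w := by
    rw [hΦ.pullback x hx, hh _ hx]
    congr 1
    exact Finset.sum_congr rfl fun j _ => by rw [hc _ hx]
  norm x hx := by rw [hΦ.norm x hx, hs _ hx]
  contDiffOn_h := hΦ.contDiffOn_h.congr hh
  contDiffOn_s := hΦ.contDiffOn_s.congr hs

theorem sum {K' : Type*} [Fintype K'] {ε' : K' → ℝ} {Φ' : K' → ℝ × (ι → ℝ) → ℝ} {h' s' : ℝ → ℝ}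
    {c' : ι → ℝ → ℝ} (hΦ : IsWarpedBlock J ε Φ h s c) (hΦ' : IsWarpedBlock J ε' Φ' h' s' c') :
    IsWarpedBlock J (Sum.elim ε ε') (Sum.elim Φ Φ') (fun t => h t + h' t) (fun t => s t + s' t)
      (fun j t => c j t + c' j t) where
  contDiffOn := by
    rintro (k | k)
    exacts [hΦ.contDiffOn k, hΦ'.contDiffOn k]
  pullback x hx v w := by
    simp only [Fintype.sum_sum_type, Sum.elim_inl, Sum.elim_inr]
    rw [hΦ.pullback x hx, hΦ'.pullback x hx]
    simp only [add_mul, Finset.sum_add_distrib]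
    ring
  norm x hx := by
    simp only [Fintype.sum_sum_type, Sum.elim_inl, Sum.elim_inr]
    rw [hΦ.norm x hx, hΦ'.norm x hx]
  contDiffOn_h := hΦ.contDiffOn_h.add hΦ'.contDiffOn_h
  contDiffOn_s := hΦ.contDiffOn_s.add hΦ'.contDiffOn_s

theorem family {α : Type*} [Fintype α] {Φ : α → K → ℝ × (ι → ℝ) → ℝ} {h s : α → ℝ → ℝ}
    {c : α → ι → ℝ → ℝ} (hΦ : ∀ i, IsWarpedBlock J ε (Φ i) (h i) (s i) (c i)) :
    IsWarpedBlock J (fun k : α × K => ε k.2) (fun k => Φ k.1 k.2) (fun t => ∑ i, h i t)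
      (fun t => ∑ i, s i t) (fun j t => ∑ i, c i j t) where
  contDiffOn k := (hΦ k.1).contDiffOn k.2
  pullback x hx v w := by
    simp only [Fintype.sum_prod_type]
    rw [Finset.sum_congr rfl fun i _ => (hΦ i).pullback x hx v w, Finset.sum_add_distrib,
      Finset.sum_mul, Finset.sum_comm]
    simp only [Finset.sum_mul]
  norm x hx := by
    simp only [Fintype.sum_prod_type]
    exact Finset.sum_congr rfl fun i _ => (hΦ i).norm x hx
  contDiffOn_h := ContDiffOn.sum fun i _ => (hΦ i).contDiffOn_h
  contDiffOn_s := ContDiffOn.sum fun i _ => (hΦ i).contDiffOn_s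

end IsWarpedBlock

/-! ### Blocks built from a single curve -/

section Blocks

variable {ι K : Type*} [Fintype ι] [Fintype K] {J : Set ℝ}

theorem contDiffOn_comp_fst {w : ℝ → ℝ} (hw : ContDiffOn ℝ ∞ w J) :
    ContDiffOn ℝ ∞ (fun x : ℝ × (ι → ℝ) => w x.1) (J ×ˢ univ) :=
  hw.comp contDiff_fst.contDiffOn fun _ hx => hx.1

theorem hasDerivAt_of_contDiffOn (hJ : IsOpen J) {w : ℝ → ℝ} (hw : ContDiffOn ℝ ∞ w J) {t : ℝ}
    (ht : t ∈ J) : HasDerivAt w (deriv w t) t :=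
  ((hw.contDiffAt (hJ.mem_nhds ht)).differentiableAt (by simp)).hasDerivAt

theorem hasFDerivAt_comp_fst (hJ : IsOpen J) {w : ℝ → ℝ} (hw : ContDiffOn ℝ ∞ w J)
    {x : ℝ × (ι → ℝ)} (hx : x.1 ∈ J) :
    HasFDerivAt (fun y : ℝ × (ι → ℝ) => w y.1)
      (deriv w x.1 • ContinuousLinearMap.fst ℝ ℝ (ι → ℝ)) x :=
  (hasDerivAt_of_contDiffOn hJ hw hx).comp_hasFDerivAt x hasFDerivAt_fst

theorem contDiffOn_deriv_of_isOpen (hJ : IsOpen J) {w : ℝ → ℝ} (hw : ContDiffOn ℝ ∞ w J) :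
    ContDiffOn ℝ ∞ (deriv w) J :=
  ((contDiffOn_infty_iff_deriv_of_isOpen hJ).1 hw).2

/-- The block of a single function of `t`. -/
theorem isWarpedBlock_single (hJ : IsOpen J) {w : ℝ → ℝ} (hw : ContDiffOn ℝ ∞ w J) (ε : ℝ) :
    IsWarpedBlock (ι := ι) J (fun _ : Unit => ε) (fun _ x => w x.1)
      (fun t => ε * deriv w t ^ 2) (fun t => ε * w t ^ 2) (fun _ _ => 0) where
  contDiffOn _ := contDiffOn_comp_fst hw
  pullback x hx v v' := by
    simp [(hasFDerivAt_comp_fst hJ hw hx).fderiv]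
    ring
  norm x hx := by
    simp only [Finset.univ_unique, Finset.sum_singleton]
    ring
  contDiffOn_h := contDiffOn_const.mul ((contDiffOn_deriv_of_isOpen hJ hw).pow 2)
  contDiffOn_s := contDiffOn_const.mul (hw.pow 2)

/-- The block `A(t) γ(Θ(t))`. -/
theorem IsUnitCurve.isWarpedBlock_curve {ε : K → ℝ} {σ : ℝ} {γ : K → ℝ → ℝ}
    (hγ : IsUnitCurve ε σ γ) (hJ : IsOpen J) {A Θ : ℝ → ℝ} (hA : ContDiffOn ℝ ∞ A J)
    (hΘ : ContDiffOn ℝ ∞ Θ J) :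
    IsWarpedBlock (ι := ι) J ε (fun k x => A x.1 * γ k (Θ x.1))
      (fun t => σ * deriv A t ^ 2 + A t ^ 2 * deriv Θ t ^ 2) (fun t => σ * A t ^ 2)
      (fun _ _ => 0) where
  contDiffOn k := (contDiffOn_comp_fst hA).mul
    ((hγ.contDiff k).comp_contDiffOn (contDiffOn_comp_fst hΘ))
  pullback x hx v w := by
    rw [hγ.pullback (hasFDerivAt_comp_fst hJ hA hx) (hasFDerivAt_comp_fst hJ hΘ hx)
      (fun k => EventuallyEq.rfl)]
    simp
    ring
  norm x hx := by
    rw [← hγ.norm (Θ x.1), Finset.sum_mul]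
    exact Finset.sum_congr rfl fun k _ => by ring
  contDiffOn_h := (contDiffOn_const.mul ((contDiffOn_deriv_of_isOpen hJ hA).pow 2)).add
    ((hA.pow 2).mul ((contDiffOn_deriv_of_isOpen hJ hΘ).pow 2))
  contDiffOn_s := contDiffOn_const.mul (hA.pow 2)

/-- The block `A(t) γ(μ(t) u j)`, where `μ` is locally constant where `A` does not vanish. -/
theorem IsUnitCurve.isWarpedBlock_coord [DecidableEq ι] {ε : K → ℝ} {σ : ℝ} {γ : K → ℝ → ℝ}
    (hγ : IsUnitCurve ε σ γ) (hJ : IsOpen J) {A μ : ℝ → ℝ} (hA : ContDiffOn ℝ ∞ A J)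
    (hμ : ∀ t ∈ J, ∃ b, μ t = b ∧ ∀ᶠ t' in 𝓝 t, A t' ≠ 0 → μ t' = b) (j : ι) :
    IsWarpedBlock J ε (fun k x => A x.1 * γ k (μ x.1 * x.2 j))
      (fun t => σ * deriv A t ^ 2) (fun t => σ * A t ^ 2)
      (Pi.single j fun t => (A t * μ t) ^ 2) := by
  -- Near each point `μ` may be replaced by a constant: where it takes another value, `A` is zero
  -- and both sides vanish. Hence no derivative of `μ` appears.
  have key : ∀ x : ℝ × (ι → ℝ), x.1 ∈ J → ∃ b, μ x.1 = b ∧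
      ∀ k, (fun y : ℝ × (ι → ℝ) => A y.1 * γ k (μ y.1 * y.2 j)) =ᶠ[𝓝 x]
        fun y => A y.1 * γ k (b * y.2 j) := by
    intro x hx
    obtain ⟨b, hb, hb'⟩ := hμ _ hx
    refine ⟨b, hb, fun k => ?_⟩
    filter_upwards [continuousAt_fst.eventually hb'] with y hy
    by_cases h0 : A y.1 = 0
    · simp [h0]
    · rw [hy h0]
  have hproj : ∀ x : ℝ × (ι → ℝ), HasFDerivAt (fun y : ℝ × (ι → ℝ) => y.2 j)
      ((ContinuousLinearMap.proj (R := ℝ) (φ := fun _ : ι => ℝ) j).comp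
        (ContinuousLinearMap.snd ℝ ℝ (ι → ℝ))) x := fun x =>
    ((ContinuousLinearMap.proj (R := ℝ) (φ := fun _ : ι => ℝ) j).comp
        (ContinuousLinearMap.snd ℝ ℝ (ι → ℝ))).hasFDerivAt
  refine ⟨fun k x hx => ?_, fun x hx v w => ?_, fun x hx => ?_, ?_, ?_⟩
  · obtain ⟨b, -, hb⟩ := key x hx.1
    refine ContDiffAt.contDiffWithinAt (ContDiffAt.congr_of_eventuallyEq ?_ (hb k))
    have h1 : ContDiffAt ℝ ∞ (fun y : ℝ × (ι → ℝ) => A y.1) x :=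
      (hA.contDiffAt (hJ.mem_nhds hx.1)).comp x contDiffAt_fst
    refine h1.mul ((hγ.contDiff k).contDiffAt.comp x ?_)
    fun_prop
  · obtain ⟨b, hb, hb'⟩ := key x hx
    rw [hγ.pullback (hasFDerivAt_comp_fst hJ hA hx) ((hproj x).const_mul b) hb',
      Finset.sum_eq_single j]
    · simp [hb]
      ring
    · intro i _ hi
      simp [Pi.single_eq_of_ne hi]
    · simp
  · rw [← hγ.norm (μ x.1 * x.2 j), Finset.sum_mul]
    exact Finset.sum_congr rfl fun k _ => by ring
  · exact contDiffOn_const.mul ((contDiffOn_deriv_of_isOpen hJ hA).pow 2)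
  · exact contDiffOn_const.mul (hA.pow 2)

end Blocks

/-! ### Step functions and the splitting of a warping function -/

section StepFunctions

variable {J : Set ℝ}

/-- Blow-up at the right end only: `1 / (sup J - t)` serves when `J` is bounded above, `t²`
otherwise. -/
theorem exists_contDiffOn_le_imp_le (hJ : IsOpen J) (hne : J.Nonempty) :
    ∃ p : ℝ → ℝ, ContDiffOn ℝ ∞ p J ∧ (∀ t ∈ J, 0 ≤ p t) ∧
      ∀ C, ∃ b ∈ J, ∀ t ∈ J, p t ≤ C → t ≤ b := by
  by_cases hb : BddAbove J
  · have hlt : ∀ t ∈ J, t < sSup J := by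
      intro t ht
      obtain ⟨s, hs, hs'⟩ := Filter.nonempty_of_mem (Filter.inter_mem
        (mem_nhdsWithin_of_mem_nhds (hJ.mem_nhds ht)) (self_mem_nhdsWithin (s := Ioi t)))
      exact lt_of_lt_of_le hs' (le_csSup hb hs)
    refine ⟨fun t => (sSup J - t)⁻¹, ?_, fun t ht => ?_, fun C => ?_⟩
    · exact (contDiffOn_const.sub contDiffOn_id).inv fun t ht => (sub_pos.2 (hlt t ht)).ne'
    · exact inv_nonneg.2 (sub_pos.2 (hlt t ht)).le
    · have hC : 0 < max C 1 := lt_max_of_lt_right one_pos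
      obtain ⟨b, hbJ, hb⟩ := exists_lt_of_lt_csSup hne
        (show sSup J - (max C 1)⁻¹ < sSup J from sub_lt_self _ (inv_pos.2 hC))
      refine ⟨b, hbJ, fun t ht h => ?_⟩
      have h1 : (max C 1)⁻¹ ≤ sSup J - t :=
        (inv_le_comm₀ (sub_pos.2 (hlt t ht)) hC).1 (h.trans (le_max_left _ _))
      linarith
  · refine ⟨fun t => t ^ 2, (contDiff_id.pow 2).contDiffOn, fun t _ => sq_nonneg t, fun C => ?_⟩
    obtain ⟨b, hbJ, hb⟩ := not_bddAbove_iff.1 hb (max C 1)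
    refine ⟨b, hbJ, fun t _ h => ?_⟩
    by_contra hlt
    have h1 := le_max_left C 1
    have h2 := le_max_right C 1
    nlinarith

/-- The one-sided functions for `J` and for its reflection `-J` are nonnegative, so a bound on their
sum bounds each and confines `t` to a closed interval inside `J`. -/
theorem exists_contDiffOn_proper (hJ : IsOpen J) (hJ' : J.OrdConnected) :
    ∃ x : ℝ → ℝ, ContDiffOn ℝ ∞ x J ∧ ∀ C, ∃ S ⊆ J, IsCompact S ∧ ∀ t ∈ J, x t ≤ C → t ∈ S := by
  rcases J.eq_empty_or_nonempty with rfl | hne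
  · exact ⟨0, contDiffOn_const, fun C => ⟨∅, Subset.rfl, isCompact_empty, by simp⟩⟩
  obtain ⟨p, hp, hp0, hpC⟩ := exists_contDiffOn_le_imp_le hJ hne
  obtain ⟨q, hq, hq0, hqC⟩ := exists_contDiffOn_le_imp_le (J := -J) hJ.neg hne.neg
  refine ⟨fun t => p t + q (-t), hp.add (hq.comp contDiff_neg.contDiffOn fun t ht => by simpa),
    fun C => ?_⟩
  obtain ⟨b, hbJ, hb⟩ := hpC C
  obtain ⟨a, haJ, ha⟩ := hqC C
  refine ⟨Icc (-a) b, hJ'.out haJ hbJ, isCompact_Icc, fun t ht h => ?_⟩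
  have h1 := hp0 t ht
  have h2 := hq0 (-t) (by simpa)
  exact ⟨by linarith [ha (-t) (by simpa) (by linarith)], hb t ht (by linarith)⟩

/-- Division of `ψ` by a step function that jumps only where `ψ` vanishes can make `ψ` and its
derivative arbitrarily small. -/
theorem exists_step_div_small (hJ : IsOpen J) {ψ y ε : ℝ → ℝ} (hψ : ContDiffOn ℝ ∞ ψ J)
    (hy : ContDiffOn ℝ ∞ y J)
    (hyC : ∀ C, ∃ S ⊆ J, IsCompact S ∧ ∀ t ∈ J, y t ≤ C → t ∈ S)
    (hψy : ∀ t ∈ J, ∀ i : ℤ, y t = i → ∀ᶠ t' in 𝓝 t, ψ t' = 0)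
    (hε : ContinuousOn ε J) (hε0 : ∀ t ∈ J, 0 < ε t) :
    ∃ μ : ℝ → ℝ, (∀ t, 0 < μ t) ∧
      (∀ t ∈ J, ∃ b, μ t = b ∧ ∀ᶠ t' in 𝓝 t, ψ t' / μ t' ≠ 0 → μ t' = b) ∧
      ContDiffOn ℝ ∞ (fun t => ψ t / μ t) J ∧ (∀ t ∈ J, |ψ t / μ t| ≤ ε t) ∧
      ∀ t ∈ J, |deriv (fun t => ψ t / μ t) t| ≤ ε t := by
  -- The set where `⌊y⌋ = i` lies in a compact part of `J`, on which `ψ / ε` and `ψ' / ε` are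
  -- bounded.
  have hbound : ∀ i : ℤ, ∃ C : ℝ, 0 < C ∧
      ∀ t ∈ J, ⌊y t⌋ = i → |ψ t| ≤ C * ε t ∧ |deriv ψ t| ≤ C * ε t := by
    intro i
    obtain ⟨S, hSJ, hS, hSi⟩ := hyC (i + 1)
    have hc1 : ContinuousOn (fun t => ψ t / ε t) S :=
      (hψ.continuousOn.div hε fun t ht => (hε0 t ht).ne').mono hSJ
    have hc2 : ContinuousOn (fun t => deriv ψ t / ε t) S :=
      ((contDiffOn_deriv_of_isOpen hJ hψ).continuousOn.div hε fun t ht => (hε0 t ht).ne').mono hSJ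
    obtain ⟨C1, hC1⟩ := hS.exists_bound_of_continuousOn hc1
    obtain ⟨C2, hC2⟩ := hS.exists_bound_of_continuousOn hc2
    refine ⟨max (max C1 C2) 1, lt_max_of_lt_right one_pos, fun t ht hti => ?_⟩
    have htS : t ∈ S := hSi t ht (by rw [← hti]; exact (Int.lt_floor_add_one _).le)
    have h1 := hC1 t htS
    have h2 := hC2 t htS
    have h0 := hε0 t ht
    rw [Real.norm_eq_abs, abs_div, abs_of_pos h0, div_le_iff₀ h0] at h1 h2
    constructor
    · exact h1.trans (mul_le_mul_of_nonneg_right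
        ((le_max_left C1 C2).trans (le_max_left _ _)) h0.le)
    · exact h2.trans (mul_le_mul_of_nonneg_right
        ((le_max_right C1 C2).trans (le_max_left _ _)) h0.le)
  choose C hC0 hC using hbound
  set μ : ℝ → ℝ := fun t => C ⌊y t⌋ with hμ
  have hμ0 : ∀ t, 0 < μ t := fun t => hC0 _
  -- The function `μ` can jump only where `y` is an integer, and `ψ` vanishes near such points.
  have hloc : ∀ t ∈ J, (∀ᶠ t' in 𝓝 t, ψ t' = 0) ∨ ∀ᶠ t' in 𝓝 t, μ t' = μ t := by
    intro t ht
    by_cases hi : y t = ⌊y t⌋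
    · exact Or.inl (hψy t ht _ hi)
    · right
      have h1 : (⌊y t⌋ : ℝ) < y t := lt_of_le_of_ne (Int.floor_le _) (Ne.symm hi)
      have h2 : ∀ᶠ t' in 𝓝 t, y t' ∈ Ioo (⌊y t⌋ : ℝ) (⌊y t⌋ + 1) :=
        (hy.continuousOn.continuousAt (hJ.mem_nhds ht)).eventually
          (Ioo_mem_nhds h1 (Int.lt_floor_add_one _))
      filter_upwards [h2] with t' ht'
      simp only [hμ]
      rw [Int.floor_eq_iff.2 ⟨ht'.1.le, ht'.2⟩]
  have hloc' : ∀ t ∈ J, (fun t' => ψ t' / μ t') =ᶠ[𝓝 t] fun t' => ψ t' / μ t := by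
    intro t ht
    rcases hloc t ht with h | h
    · filter_upwards [h] with t' ht'
      simp [ht']
    · filter_upwards [h] with t' ht'
      rw [ht']
  refine ⟨μ, hμ0, fun t ht => ⟨_, rfl, ?_⟩, fun t ht => ?_, fun t ht => ?_, fun t ht => ?_⟩
  · rcases hloc t ht with h | h
    · filter_upwards [h] with t' ht' hne
      simp [ht'] at hne
    · filter_upwards [h] with t' ht' _ using ht'
  · exact (((hψ.contDiffAt (hJ.mem_nhds ht)).div_const _).congr_of_eventuallyEq
      (hloc' t ht)).contDiffWithinAt
  · rw [abs_div, abs_of_pos (hμ0 t), div_le_iff₀ (hμ0 t), mul_comm]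
    exact (hC _ t ht rfl).1
  · rw [(hloc' t ht).deriv_eq, deriv_div_const, abs_div, abs_of_pos (hμ0 t), div_le_iff₀ (hμ0 t),
      mul_comm]
    exact (hC _ t ht rfl).2

/-- A `1`-periodic smooth function that vanishes near the integers, and whose translate by `1 / 2`
is a function with complementary square. -/
theorem exists_periodic_partition :
    ∃ φ : ℝ → ℝ, ContDiff ℝ ∞ φ ∧ (∀ x, φ x ^ 2 + φ (x + 1 / 2) ^ 2 = 1) ∧
      ∀ i : ℤ, ∀ᶠ x in 𝓝 (i : ℝ), φ x = 0 := by
  -- The argument of the sine runs between `0` and `π / 2`; translation by `1 / 2` changes the sign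
  -- of the cosine, and the symmetry of the transition function about `1 / 2` then turns sine into
  -- cosine. Near integers the cosine exceeds `1 / 2`, so the transition is zero.
  refine ⟨fun x => Real.sin (Real.pi / 2 *
    Real.smoothTransition (1 / 2 - Real.cos (2 * Real.pi * x))), ?_, fun x => ?_, fun i => ?_⟩
  · refine Real.contDiff_sin.comp (contDiff_const.mul (Real.smoothTransition.contDiff.comp ?_))
    exact contDiff_const.sub (Real.contDiff_cos.comp (contDiff_const.mul contDiff_id))
  · have h1 : Real.cos (2 * Real.pi * (x + 1 / 2)) = -Real.cos (2 * Real.pi * x) := by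
      rw [← Real.cos_add_pi]
      congr 1
      ring
    have h2 : ∀ z, Real.smoothTransition (1 / 2 + z) =
        1 - Real.smoothTransition (1 / 2 - z) := by
      intro z
      have h3 := Real.smoothTransition.pos_denom (1 / 2 - z)
      have h4 : (1 : ℝ) - (1 / 2 - z) = 1 / 2 + z := by ring
      have h5 : (1 : ℝ) - (1 / 2 + z) = 1 / 2 - z := by ring
      rw [h4] at h3
      rw [Real.smoothTransition, Real.smoothTransition, h4, h5]
      rw [add_comm (expNegInvGlue (1 / 2 + z)), eq_sub_iff_add_eq, ← add_div, add_comm,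
        div_self h3.ne']
    simp only
    rw [h1, sub_neg_eq_add, h2]
    have h6 : ∀ z, Real.pi / 2 * (1 - z) = Real.pi / 2 - Real.pi / 2 * z := fun z => by ring
    rw [h6, Real.sin_pi_div_two_sub, Real.sin_sq_add_cos_sq]
  · have h1 : ContinuousAt (fun x => Real.cos (2 * Real.pi * x)) (i : ℝ) := by fun_prop
    have h2 : Real.cos (2 * Real.pi * i) = 1 := by
      rw [mul_comm]
      exact Real.cos_int_mul_two_pi i
    have h3 : ∀ᶠ x in 𝓝 (i : ℝ), 1 / 2 < Real.cos (2 * Real.pi * x) :=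
      h1.eventually (lt_mem_nhds (by simp only [h2]; norm_num))
    filter_upwards [h3] with x hx
    rw [Real.smoothTransition.zero_of_nonpos (by linarith)]
    simp

/-- A positive function `η` decomposes as `η² = ∑ b, (A b * μ b)²`, where `μ b` is locally constant
where `A b` does not vanish, and `A b` is arbitrarily small together with its derivative. -/
theorem exists_twist_decomposition (hJ : IsOpen J) (hJ' : J.OrdConnected) {η ε : ℝ → ℝ}
    (hη : ContDiffOn ℝ ∞ η J) (hε : ContinuousOn ε J) (hε0 : ∀ t ∈ J, 0 < ε t) :
    ∃ A μ : Bool → ℝ → ℝ, (∀ b t, 0 < μ b t) ∧ (∀ b, ContDiffOn ℝ ∞ (A b) J) ∧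
      (∀ b, ∀ t ∈ J, ∃ d, μ b t = d ∧ ∀ᶠ t' in 𝓝 t, A b t' ≠ 0 → μ b t' = d) ∧
      (∀ t ∈ J, ∑ b, (A b t * μ b t) ^ 2 = η t ^ 2) ∧
      (∀ b, ∀ t ∈ J, |A b t| ≤ ε t) ∧ ∀ b, ∀ t ∈ J, |deriv (A b) t| ≤ ε t := by
  obtain ⟨x, hx, hxC⟩ := exists_contDiffOn_proper hJ hJ'
  obtain ⟨φ, hφ, hφ1, hφ0⟩ := exists_periodic_partition
  have key : ∀ d : ℝ, ∃ μ : ℝ → ℝ, (∀ t, 0 < μ t) ∧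
      (∀ t ∈ J, ∃ b, μ t = b ∧ ∀ᶠ t' in 𝓝 t, η t' * φ (x t' + d) / μ t' ≠ 0 → μ t' = b) ∧
      ContDiffOn ℝ ∞ (fun t => η t * φ (x t + d) / μ t) J ∧
      (∀ t ∈ J, |η t * φ (x t + d) / μ t| ≤ ε t) ∧
      ∀ t ∈ J, |deriv (fun t => η t * φ (x t + d) / μ t) t| ≤ ε t := by
    intro d
    have hy : ContDiffOn ℝ ∞ (fun t => x t + d) J := hx.add contDiffOn_const
    refine exists_step_div_small hJ (hη.mul (hφ.comp_contDiffOn hy)) hy (fun C => ?_)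
      (fun t ht i hi => ?_) hε hε0
    · obtain ⟨S, hS, hS', h⟩ := hxC (C - d)
      exact ⟨S, hS, hS', fun t ht h' => h t ht (by linarith)⟩
    · have h1 := hφ0 i
      rw [← hi] at h1
      filter_upwards [(hy.continuousOn.continuousAt (hJ.mem_nhds ht)).eventually h1] with t' ht'
      simp [ht']
  choose μ hμ0 hμ hA hA1 hA2 using key
  -- The two pieces are `η φ(x)` and `η φ(x + 1/2)`, whose squares add up to `η²`, each divided by
  -- its own step function.
  refine ⟨fun b t => η t * φ (x t + bif b then 1 / 2 else 0) / μ (bif b then 1 / 2 else 0) t,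
    fun b => μ (bif b then 1 / 2 else 0), fun b => hμ0 _, fun b => hA _, fun b => hμ _,
    fun t ht => ?_, fun b => hA1 _, fun b => hA2 _⟩
  simp only [Fintype.sum_bool, cond_true, cond_false]
  rw [div_mul_cancel₀ _ (hμ0 _ t).ne', div_mul_cancel₀ _ (hμ0 _ t).ne', add_zero, mul_pow, mul_pow,
    ← mul_add, add_comm, hφ1, mul_one]

end StepFunctions

/-! ### Reading off parameters along a filter -/

section Recovery

variable {X : Type*} {𝓕 : Filter X}

/-- Dividing by the radius, which stays away from zero, gives convergence on the curve itself. -/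
theorem tendsto_angle_of_mul_curve {K : Type*} {γ : K → ℝ → ℝ}
    (hγ : IsInducing fun θ k => γ k θ) {r θ : X → ℝ} {r₀ θ₀ : ℝ} (hr : Tendsto r 𝓕 (𝓝 r₀))
    (hr₀ : r₀ ≠ 0) (h : ∀ k, Tendsto (fun x => r x * γ k (θ x)) 𝓕 (𝓝 (r₀ * γ k θ₀))) :
    Tendsto θ 𝓕 (𝓝 θ₀) := by
  rw [hγ.tendsto_nhds_iff, tendsto_pi_nhds]
  intro k
  have h1 := (h k).div hr hr₀
  rw [mul_div_cancel_left₀ _ hr₀] at h1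
  refine h1.congr' ?_
  filter_upwards [hr.eventually_ne hr₀] with x hx
  simp [hx]

/-- Openness provides comparison points of `J` on both sides of `t`, so order alone suffices and
continuity of `Θ` plays no role. -/
theorem tendsto_of_strictMonoOn {J : Set ℝ} (hJ : IsOpen J) {Θ : ℝ → ℝ} (hΘ : StrictMonoOn Θ J)
    {T : X → ℝ} {t : ℝ} (ht : t ∈ J) (hT : ∀ᶠ x in 𝓕, T x ∈ J)
    (h : Tendsto (fun x => Θ (T x)) 𝓕 (𝓝 (Θ t))) : Tendsto T 𝓕 (𝓝 t) := by
  rw [tendsto_order]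
  constructor
  · intro a ha
    obtain ⟨b, ⟨hbJ, hab⟩, hbt⟩ := Filter.nonempty_of_mem (Filter.inter_mem (Filter.inter_mem
      (mem_nhdsWithin_of_mem_nhds (hJ.mem_nhds ht)) (mem_nhdsWithin_of_mem_nhds (Ioi_mem_nhds ha)))
      (self_mem_nhdsWithin (s := Iio t)))
    filter_upwards [hT, h.eventually (lt_mem_nhds (hΘ hbJ ht hbt))] with x hx hx'
    exact lt_trans hab ((hΘ.lt_iff_lt hbJ hx).1 hx')
  · intro a ha
    obtain ⟨b, ⟨hbJ, hab⟩, hbt⟩ := Filter.nonempty_of_mem (Filter.inter_mem (Filter.inter_mem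
      (mem_nhdsWithin_of_mem_nhds (hJ.mem_nhds ht)) (mem_nhdsWithin_of_mem_nhds (Iio_mem_nhds ha)))
      (self_mem_nhdsWithin (s := Ioi t)))
    filter_upwards [hT, h.eventually (gt_mem_nhds (hΘ ht hbJ hbt))] with x hx hx'
    exact lt_trans ((hΘ.lt_iff_lt hx hbJ).1 hx') hab

end Recovery

/-! ### Antiderivatives and monotonicity on an interval -/

section Antiderivative

variable {J : Set ℝ}

theorem exists_antiderivative (hJ : IsOpen J) (hJ' : J.OrdConnected) {f : ℝ → ℝ}
    (hf : ContDiffOn ℝ ∞ f J) :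
    ∃ Θ : ℝ → ℝ, ContDiffOn ℝ ∞ Θ J ∧ ∀ t ∈ J, deriv Θ t = f t := by
  rcases J.eq_empty_or_nonempty with rfl | ⟨t₀, ht₀⟩
  · exact ⟨0, contDiffOn_const, by simp⟩
  have hd : ∀ t ∈ J, HasDerivAt (fun t => ∫ s in t₀..t, f s) (f t) t := by
    intro t ht
    refine intervalIntegral.integral_hasDerivAt_right
      ((hf.continuousOn.mono (hJ'.uIcc_subset ht₀ ht)).intervalIntegrable)
      (hf.continuousOn.stronglyMeasurableAtFilter hJ t ht)
      (hf.continuousOn.continuousAt (hJ.mem_nhds ht))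
  refine ⟨fun t => ∫ s in t₀..t, f s, ?_, fun t ht => (hd t ht).deriv⟩
  rw [contDiffOn_infty_iff_deriv_of_isOpen hJ]
  exact ⟨fun t ht => (hd t ht).differentiableAt.differentiableWithinAt,
    hf.congr fun t ht => (hd t ht).deriv⟩

theorem strictMonoOn_of_deriv_pos_of_isOpen (hJ : IsOpen J) (hJ' : J.OrdConnected) {Θ : ℝ → ℝ}
    (hΘ : ContDiffOn ℝ ∞ Θ J) (h : ∀ t ∈ J, 0 < deriv Θ t) : StrictMonoOn Θ J :=
  strictMonoOn_of_deriv_pos hJ'.convex hΘ.continuousOn (by rwa [hJ.interior_eq])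

theorem contDiffOn_sqrt_of_pos {f : ℝ → ℝ} (hf : ContDiffOn ℝ ∞ f J) (h : ∀ t ∈ J, 0 < f t) :
    ContDiffOn ℝ ∞ (fun t => √(f t)) J :=
  hf.sqrt fun t ht => (h t ht).ne'

end Antiderivative

/-! ### Small positive definite blocks -/

section Blocks

variable {ι β K : Type*} [Fintype ι] [DecidableEq ι] [Fintype β] [Fintype K] {J : Set ℝ}

/-- The positive definite block with `c = η j ^ 2` at the coordinate `e j`, with `h` and `s`
small. -/
theorem IsUnitCurve.exists_block_small {γ : K → ℝ → ℝ} (hγ : IsUnitCurve (fun _ => 1) 1 γ)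
    (hJ : IsOpen J) (hJ' : J.OrdConnected) {η : β → ℝ → ℝ} (hη : ∀ j, ContDiffOn ℝ ∞ (η j) J)
    (hη0 : ∀ j, ∀ t ∈ J, 0 < η j t) {ε : ℝ → ℝ} (hε : ContinuousOn ε J)
    (hε0 : ∀ t ∈ J, 0 < ε t) (e : β → ι) :
    ∃ (Φ : β × Bool × K → ℝ × (ι → ℝ) → ℝ) (h s : ℝ → ℝ),
      IsWarpedBlock J (fun _ => 1) Φ h s (fun i t => ∑ j, Pi.single (M := fun _ => ℝ → ℝ) (e j)
        (fun t => η j t ^ 2) i t) ∧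
      (∀ t ∈ J, 0 ≤ h t ∧ h t ≤ ε t) ∧ (∀ t ∈ J, 0 ≤ s t ∧ s t ≤ ε t) ∧
      (∀ t ∈ J, |deriv s t| ≤ ε t) ∧
      ((IsInducing fun θ k => γ k θ) → ∀ (𝓕 : Filter (ℝ × (ι → ℝ))) (x : ℝ × (ι → ℝ)), x.1 ∈ J →
        Tendsto Prod.fst 𝓕 (𝓝 x.1) → (∀ k, Tendsto (Φ k) 𝓕 (𝓝 (Φ k x))) →
        ∀ j, Tendsto (fun y => y.2 (e j)) 𝓕 (𝓝 (x.2 (e j)))) := by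
  -- There are `2 |β|` pieces, each contributing at most `δ²` to `h` and `s` and at most `2 δ²` to
  -- `s'`. As `δ ≤ 1`, the total is at most `4 |β| δ² ≤ N δ ≤ ε`.
  set N : ℝ := 4 * Fintype.card β + 1 with hN
  have hN0 : 0 < N := by positivity
  set δ : ℝ → ℝ := fun t => min 1 (ε t / N) with hδ
  have hδ0 : ∀ t ∈ J, 0 < δ t := fun t ht => lt_min one_pos (div_pos (hε0 t ht) hN0)
  have hδN : ∀ t ∈ J, 4 * Fintype.card β * δ t ^ 2 ≤ ε t := by
    intro t ht
    have h0 := hδ0 t ht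
    have h1 : δ t ≤ 1 := min_le_left _ _
    have h2 : δ t * N ≤ ε t := (le_div_iff₀ hN0).1 (min_le_right _ _)
    calc 4 * Fintype.card β * δ t ^ 2 ≤ N * δ t ^ 2 := by
          have := sq_nonneg (δ t)
          rw [hN]
          linarith
      _ ≤ N * δ t := mul_le_mul_of_nonneg_left (by nlinarith) hN0.le
      _ ≤ ε t := by linarith
  have hδc : ContinuousOn δ J := continuousOn_const.inf (hε.div_const N)
  choose A μ hμ0 hA hμ hAμ hAδ hAδ' using fun j =>
    exists_twist_decomposition hJ hJ' (hη j) hδc hδ0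
  have hblock := IsWarpedBlock.family fun j => IsWarpedBlock.family fun b =>
    hγ.isWarpedBlock_coord hJ (hA j b) (hμ j b) (e j)
  have hd : ∀ j b, ∀ t ∈ J, HasDerivAt (A j b) (deriv (A j b) t) t := fun j b t ht =>
    hasDerivAt_of_contDiffOn hJ (hA j b) ht
  have hsum : ∀ (f : β → Bool → ℝ) (d : ℝ), (∀ j b, f j b ≤ d) →
      ∑ j, ∑ b, f j b ≤ 2 * Fintype.card β * d := by
    intro f d hf
    calc ∑ j, ∑ b, f j b ≤ ∑ _j : β, ∑ _b : Bool, d :=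
          Finset.sum_le_sum fun j _ => Finset.sum_le_sum fun b _ => hf j b
      _ = 2 * Fintype.card β * d := by
          simp
          ring
  have hsq : ∀ t ∈ J, 0 ≤ Fintype.card β * δ t ^ 2 := fun t _ => by positivity
  refine ⟨_, _, _, hblock.congr (fun t _ => rfl) (fun t _ => rfl) fun t ht i => ?_,
    fun t ht => ⟨?_, ?_⟩, fun t ht => ⟨?_, ?_⟩, fun t ht => ?_, ?_⟩
  · refine Finset.sum_congr rfl fun j _ => ?_
    by_cases hi : i = e j
    · subst hi
      simp only [Pi.single_eq_same]
      exact (hAμ j t ht).symm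
    · simp [Pi.single_eq_of_ne hi]
  · exact Finset.sum_nonneg fun j _ => Finset.sum_nonneg fun b _ => by positivity
  · refine (hsum _ (δ t ^ 2) fun j b => ?_).trans ?_
    · rw [one_mul, ← sq_abs]
      exact pow_le_pow_left₀ (abs_nonneg _) (hAδ' j b t ht) 2
    · linarith [hδN t ht, hsq t ht]
  · exact Finset.sum_nonneg fun j _ => Finset.sum_nonneg fun b _ => by positivity
  · refine (hsum _ (δ t ^ 2) fun j b => ?_).trans ?_
    · rw [one_mul, ← sq_abs]
      exact pow_le_pow_left₀ (abs_nonneg _) (hAδ j b t ht) 2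
    · linarith [hδN t ht, hsq t ht]
  · have h1 : HasDerivAt (fun t => ∑ j, ∑ b, 1 * A j b t ^ 2)
        (∑ j, ∑ b, 2 * (A j b t * deriv (A j b) t)) t := by
      refine HasDerivAt.fun_sum fun j _ => HasDerivAt.fun_sum fun b _ => ?_
      have h2 := ((hd j b t ht).pow 2).const_mul 1
      refine h2.congr_deriv ?_
      simp
      ring
    rw [h1.deriv]
    refine (Finset.abs_sum_le_sum_abs _ _).trans ((Finset.sum_le_sum fun j _ =>
      Finset.abs_sum_le_sum_abs _ _).trans ((hsum _ (2 * δ t ^ 2) fun j b => ?_).trans ?_))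
    · rw [abs_mul, abs_mul, abs_two, sq]
      exact mul_le_mul_of_nonneg_left (mul_le_mul (hAδ j b t ht) (hAδ' j b t ht) (abs_nonneg _)
        (hδ0 t ht).le) zero_le_two
    · linarith [hδN t ht]
  · intro hind 𝓕 x hx hfst hΦ j
    -- The two amplitudes cannot both vanish since `η > 0`. A piece with nonzero amplitude yields `μ
    -- u`, and `μ` is a nonzero constant along the filter.
    obtain ⟨b, hb⟩ : ∃ b, A j b x.1 ≠ 0 := by
      by_contra! hall
      have h1 := hAμ j x.1 hx
      have h2 := hη0 j x.1 hx
      simp only [hall, zero_mul, Fintype.sum_bool] at h1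
      nlinarith
    have hA0 : Tendsto (fun y : ℝ × (ι → ℝ) => A j b y.1) 𝓕 (𝓝 (A j b x.1)) :=
      ((hA j b).continuousOn.continuousAt (hJ.mem_nhds hx)).tendsto.comp hfst
    have h1 := tendsto_angle_of_mul_curve (θ := fun y : ℝ × (ι → ℝ) => μ j b y.1 * y.2 (e j))
      (θ₀ := μ j b x.1 * x.2 (e j)) hind hA0 hb fun k => hΦ (j, b, k)
    obtain ⟨d, hd, hd'⟩ := hμ j b x.1 hx
    have hd0 : d ≠ 0 := hd ▸ (hμ0 j b x.1).ne'
    have h2 : Tendsto (fun y : ℝ × (ι → ℝ) => d⁻¹ * (μ j b y.1 * y.2 (e j))) 𝓕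
        (𝓝 (d⁻¹ * (d * x.2 (e j)))) := by
      rw [hd] at h1
      exact h1.const_mul _
    rw [inv_mul_cancel_left₀ hd0] at h2
    refine h2.congr' ?_
    filter_upwards [hfst.eventually hd', hA0.eventually_ne hb] with y hy hy'
    rw [hy hy', inv_mul_cancel_left₀ hd0]

end Blocks

/-! ### The closing block -/

section Closing

variable {ι K : Type*} [Fintype ι] [Fintype K] {J : Set ℝ}

/-- The quadric forces `r² = C - σ s`, hence `r r' = -σ s' / 2`, and the metric forces `r² Θ'² = ρ²
- h - σ r'²`. Multiplied by `r²`, positivity of the right side is exactly `hpos'`. -/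
theorem exists_radius_angle (hJ : IsOpen J) (hJ' : J.OrdConnected) {h s ρ : ℝ → ℝ}
    (hh : ContDiffOn ℝ ∞ h J) (hs : ContDiffOn ℝ ∞ s J) (hρ : ContDiffOn ℝ ∞ ρ J) {σ C : ℝ}
    (hσ : σ * σ = 1) (hpos : ∀ t ∈ J, 0 < C - σ * s t)
    (hpos' : ∀ t ∈ J, σ * deriv s t ^ 2 / 4 < (ρ t ^ 2 - h t) * (C - σ * s t)) :
    ∃ r Θ : ℝ → ℝ, ContDiffOn ℝ ∞ r J ∧ ContDiffOn ℝ ∞ Θ J ∧ (∀ t ∈ J, 0 < r t) ∧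
      (∀ t ∈ J, s t + σ * r t ^ 2 = σ * C) ∧ (∀ t ∈ J, 0 < deriv Θ t) ∧
      ∀ t ∈ J, h t + (σ * deriv r t ^ 2 + r t ^ 2 * deriv Θ t ^ 2) = ρ t ^ 2 := by
  have hq : ContDiffOn ℝ ∞ (fun t => C - σ * s t) J := contDiffOn_const.sub (contDiffOn_const.mul hs)
  set r : ℝ → ℝ := fun t => √(C - σ * s t) with hr_def
  have hr : ContDiffOn ℝ ∞ r J := contDiffOn_sqrt_of_pos hq hpos
  have hr0 : ∀ t ∈ J, 0 < r t := fun t ht => Real.sqrt_pos.2 (hpos t ht)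
  have hr2 : ∀ t ∈ J, r t ^ 2 = C - σ * s t := fun t ht => Real.sq_sqrt (hpos t ht).le
  have hr' : ∀ t ∈ J, r t ^ 2 * deriv r t ^ 2 = deriv s t ^ 2 / 4 := by
    intro t ht
    have h1 : HasDerivAt (fun t => r t ^ 2) _ t := (hasDerivAt_of_contDiffOn hJ hr ht).pow 2
    have h2 : HasDerivAt (fun t => C - σ * s t) _ t :=
      ((hasDerivAt_of_contDiffOn hJ hs ht).const_mul σ).const_sub C
    have h3 := (h1.congr_of_eventuallyEq
      (Filter.eventually_of_mem (hJ.mem_nhds ht) fun t ht => (hr2 t ht).symm)).unique h2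
    have h4 : r t * deriv r t = -(σ * deriv s t) / 2 := by
      rw [← h3]
      simp
      ring
    calc r t ^ 2 * deriv r t ^ 2 = (r t * deriv r t) ^ 2 := by ring
      _ = (σ * σ) * deriv s t ^ 2 / 4 := by
        rw [h4]
        ring
      _ = deriv s t ^ 2 / 4 := by rw [hσ, one_mul]
  have hG : ContDiffOn ℝ ∞ (fun t => (ρ t ^ 2 - h t - σ * deriv r t ^ 2) / r t ^ 2) J :=
    ((((hρ.pow 2).sub hh)).sub (contDiffOn_const.mul
      ((contDiffOn_deriv_of_isOpen hJ hr).pow 2))).div (hr.pow 2)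
      fun t ht => (pow_pos (hr0 t ht) 2).ne'
  have hG0 : ∀ t ∈ J, 0 < (ρ t ^ 2 - h t - σ * deriv r t ^ 2) / r t ^ 2 := by
    intro t ht
    have h1 := pow_pos (hr0 t ht) 2
    refine div_pos (pos_of_mul_pos_left ?_ h1.le) h1
    have h2 := hpos' t ht
    have h3 : (ρ t ^ 2 - h t - σ * deriv r t ^ 2) * r t ^ 2 =
        (ρ t ^ 2 - h t) * r t ^ 2 - σ * (r t ^ 2 * deriv r t ^ 2) := by ring
    rw [h3, hr' t ht, hr2 t ht]
    linarith
  obtain ⟨Θ, hΘ, hΘ'⟩ := exists_antiderivative hJ hJ' (contDiffOn_sqrt_of_pos hG hG0)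
  refine ⟨r, Θ, hr, hΘ, hr0, fun t ht => ?_, fun t ht => ?_, fun t ht => ?_⟩
  · rw [hr2 t ht]
    linear_combination (-s t) * hσ
  · rw [hΘ' t ht]
    exact Real.sqrt_pos.2 (hG0 t ht)
  · rw [hΘ' t ht, Real.sq_sqrt (hG0 t ht).le, mul_div_cancel₀ _ (pow_pos (hr0 t ht) 2).ne']
    ring

/-- A block with `h` and `s` suitably bounded extends by a curve `r(t) γ(Θ(t))` so as to take
values in a quadric, and to have `h = ρ ^ 2`. -/
theorem IsUnitCurve.exists_closing_block {ε : K → ℝ} {σ : ℝ} {γ : K → ℝ → ℝ}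
    (hγ : IsUnitCurve ε σ γ) (hJ : IsOpen J) (hJ' : J.OrdConnected) {h s ρ : ℝ → ℝ}
    (hh : ContDiffOn ℝ ∞ h J) (hs : ContDiffOn ℝ ∞ s J) (hρ : ContDiffOn ℝ ∞ ρ J) {C : ℝ}
    (hσ : σ * σ = 1) (hpos : ∀ t ∈ J, 0 < C - σ * s t)
    (hpos' : ∀ t ∈ J, σ * deriv s t ^ 2 / 4 < (ρ t ^ 2 - h t) * (C - σ * s t)) :
    ∃ (Φ : K → ℝ × (ι → ℝ) → ℝ) (h' s' : ℝ → ℝ), IsWarpedBlock J ε Φ h' s' (fun _ _ => 0) ∧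
      (∀ t ∈ J, h t + h' t = ρ t ^ 2) ∧ (∀ t ∈ J, s t + s' t = σ * C) ∧
      (∃ r Θ : ℝ → ℝ, (∀ t ∈ J, 0 < r t) ∧ Φ = fun k x => r x.1 * γ k (Θ x.1)) ∧
      ((IsInducing fun θ k => γ k θ) → ∀ (𝓕 : Filter (ℝ × (ι → ℝ))) (x : ℝ × (ι → ℝ)), x.1 ∈ J →
        (∀ᶠ y in 𝓕, y.1 ∈ J) → (∀ k, Tendsto (Φ k) 𝓕 (𝓝 (Φ k x))) →
        Tendsto Prod.fst 𝓕 (𝓝 x.1)) := by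
  obtain ⟨r, Θ, hr, hΘ, hr0, hrs, hΘ0, hΘρ⟩ :=
    exists_radius_angle hJ hJ' hh hs hρ hσ hpos hpos'
  have hblock := hγ.isWarpedBlock_curve (ι := ι) hJ hr hΘ
  refine ⟨_, _, _, hblock, hΘρ, hrs, ⟨r, Θ, hr0, rfl⟩, fun hind 𝓕 x hx hJ𝓕 hΦ => ?_⟩
  -- The radius is a continuous function of the block, through its quadratic form; then the angle,
  -- and `t` by monotonicity of `Θ`, can be recovered.
  have hnorm : ∀ y : ℝ × (ι → ℝ), y.1 ∈ J →
      √(σ * ∑ k, ε k * (r y.1 * γ k (Θ y.1) * (r y.1 * γ k (Θ y.1)))) = r y.1 := by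
    intro y hy
    rw [hblock.norm y hy, ← mul_assoc, hσ, one_mul, Real.sqrt_sq (hr0 _ hy).le]
  have hr𝓕 : Tendsto (fun y : ℝ × (ι → ℝ) => r y.1) 𝓕 (𝓝 (r x.1)) := by
    have h1 : Tendsto (fun y : ℝ × (ι → ℝ) =>
        √(σ * ∑ k, ε k * (r y.1 * γ k (Θ y.1) * (r y.1 * γ k (Θ y.1))))) 𝓕
        (𝓝 (√(σ * ∑ k, ε k * (r x.1 * γ k (Θ x.1) * (r x.1 * γ k (Θ x.1)))))) :=
      ((tendsto_finsetSum _ fun k _ => ((hΦ k).mul (hΦ k)).const_mul _).const_mul _).sqrt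
    rw [hnorm x hx] at h1
    exact h1.congr' (hJ𝓕.mono hnorm)
  exact tendsto_of_strictMonoOn hJ (strictMonoOn_of_deriv_pos_of_isOpen hJ hJ' hΘ hΘ0) hx hJ𝓕
    (tendsto_angle_of_mul_curve hind hr𝓕 (hr0 _ hx).ne' hΦ)

/-- A block with `h < ρ ^ 2` extends by a function of `t` so as to have `h = ρ ^ 2`. -/
theorem exists_closing_block_single (hJ : IsOpen J) (hJ' : J.OrdConnected) {h ρ : ℝ → ℝ}
    (hh : ContDiffOn ℝ ∞ h J) (hρ : ContDiffOn ℝ ∞ ρ J) (hpos : ∀ t ∈ J, h t < ρ t ^ 2) :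
    ∃ (Φ : Unit → ℝ × (ι → ℝ) → ℝ) (h' s' : ℝ → ℝ),
      IsWarpedBlock J (fun _ => 1) Φ h' s' (fun _ _ => 0) ∧ (∀ t ∈ J, h t + h' t = ρ t ^ 2) ∧
      ∀ (𝓕 : Filter (ℝ × (ι → ℝ))) (x : ℝ × (ι → ℝ)), x.1 ∈ J →
        (∀ᶠ y in 𝓕, y.1 ∈ J) → (∀ k, Tendsto (Φ k) 𝓕 (𝓝 (Φ k x))) →
        Tendsto Prod.fst 𝓕 (𝓝 x.1) := by
  have hG : ContDiffOn ℝ ∞ (fun t => ρ t ^ 2 - h t) J := (hρ.pow 2).sub hh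
  have hG0 : ∀ t ∈ J, 0 < ρ t ^ 2 - h t := fun t ht => sub_pos.2 (hpos t ht)
  obtain ⟨Θ, hΘ, hΘ'⟩ := exists_antiderivative hJ hJ' (contDiffOn_sqrt_of_pos hG hG0)
  refine ⟨_, _, _, isWarpedBlock_single hJ hΘ 1, fun t ht => ?_, fun 𝓕 x hx hJ𝓕 hΦ => ?_⟩
  · rw [hΘ' t ht, Real.sq_sqrt (hG0 t ht).le]
    ring
  · refine tendsto_of_strictMonoOn hJ (strictMonoOn_of_deriv_pos_of_isOpen hJ hJ' hΘ
      fun t ht => ?_) hx hJ𝓕 (hΦ ())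
    rw [hΘ' t ht]
    exact Real.sqrt_pos.2 (hG0 t ht)

end Closing

/-! ### The hyperbola, the circle and an embedded spherical curve -/

section Curves

theorem isInducing_of_strictMono {f : ℝ → ℝ} (hf : StrictMono f) (hc : Continuous f) :
    IsInducing f := by
  have : (range f).OrdConnected := (isPreconnected_range hc).ordConnected
  exact (hf.isEmbedding_of_ordConnected this).isInducing

theorem isInducing_of_coord {K : Type*} {γ : K → ℝ → ℝ} (hγ : ∀ k, Continuous (γ k)) (k : K)
    (hk : StrictMono (γ k)) : IsInducing fun θ k => γ k θ :=
  IsInducing.of_comp (continuous_pi hγ) (continuous_apply k)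
    (isInducing_of_strictMono hk (hγ k))

/-- The signs of the scalar product of `ℝ²₁`. -/
def lorentzSign : Unit ⊕ Unit → ℝ := Sum.elim (fun _ => -1) fun _ => 1

/-- The unit hyperbola. -/
noncomputable def hyperbola : Unit ⊕ Unit → ℝ → ℝ := Sum.elim (fun _ => Real.cosh) fun _ => Real.sinh

theorem isUnitCurve_hyperbola : IsUnitCurve lorentzSign (-1) hyperbola where
  contDiff := by
    rintro (k | k)
    exacts [Real.contDiff_cosh, Real.contDiff_sinh]
  norm θ := by
    simp [lorentzSign, hyperbola]
    linarith [Real.cosh_sq θ]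
  speed θ := by
    simp [lorentzSign, hyperbola]
    linarith [Real.cosh_sq θ]

theorem isInducing_hyperbola : IsInducing fun θ k => hyperbola k θ :=
  isInducing_of_coord (fun k => (isUnitCurve_hyperbola.contDiff k).continuous) (Sum.inr ())
    Real.sinh_strictMono

/-- The unit circle. -/
noncomputable def unitCircleCurve : Fin 2 → ℝ → ℝ := ![Real.cos, Real.sin]

theorem isUnitCurve_unitCircleCurve : IsUnitCurve (fun _ => 1) 1 unitCircleCurve where
  contDiff k := by
    fin_cases k
    exacts [Real.contDiff_cos, Real.contDiff_sin]
  norm θ := by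
    simp [unitCircleCurve]
    linarith [Real.sin_sq_add_cos_sq θ]
  speed θ := by
    simp [unitCircleCurve]
    linarith [Real.sin_sq_add_cos_sq θ]

/-- There is an embedded curve of unit speed and infinite length in the unit sphere `𝕊³`. -/
theorem exists_isUnitCurve_isInducing : ∃ γ : Fin 4 → ℝ → ℝ, IsUnitCurve (fun _ => 1) 1 γ ∧
    IsInducing fun θ k => γ k θ := by
  -- The curve has latitude `φ` and longitude `p`. Halving the arctangent keeps `φ' ≤ 1 / 2`, so
  -- that `√(1 - φ'²)` is smooth.
  set φ : ℝ → ℝ := fun u => Real.arctan u / 2 with hφ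
  set φ' : ℝ → ℝ := fun u => 1 / (1 + u ^ 2) / 2 with hφ'
  have hφd : ∀ u, HasDerivAt φ (φ' u) u := fun u => (Real.hasDerivAt_arctan u).div_const 2
  have hφc : ContDiff ℝ ∞ φ := Real.contDiff_arctan.div_const 2
  have hpos : ∀ u : ℝ, 0 < 1 + u ^ 2 := fun u => by positivity
  have hφ'c : ContDiff ℝ ∞ φ' :=
    (contDiff_const.div (contDiff_const.add (contDiff_id.pow 2)) fun u => (hpos u).ne').div_const 2
  have hφ'1 : ∀ u, 0 < 1 - φ' u ^ 2 := by
    intro u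
    have h1 : 1 / (1 + u ^ 2) ≤ 1 := (div_le_one (hpos u)).2 (by nlinarith [sq_nonneg u])
    have h2 : 0 < 1 / (1 + u ^ 2) := one_div_pos.2 (hpos u)
    simp only [hφ']
    nlinarith
  have hmem : ∀ u, φ u ∈ Ioo (-(Real.pi / 2)) (Real.pi / 2) := by
    intro u
    have h1 := Real.neg_pi_div_two_lt_arctan u
    have h2 := Real.arctan_lt_pi_div_two u
    have h3 := Real.pi_pos
    constructor <;> simp only [hφ] <;> linarith
  have hcos : ∀ u, 0 < Real.cos (φ u) := fun u => Real.cos_pos_of_mem_Ioo (hmem u)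
  have hg : ContDiff ℝ ∞ fun u => √(1 - φ' u ^ 2) / Real.cos (φ u) :=
    ((contDiff_const.sub (hφ'c.pow 2)).sqrt fun u => (hφ'1 u).ne').div
      (Real.contDiff_cos.comp hφc) fun u => (hcos u).ne'
  -- Unit speed means `φ'² + cos² φ · p'² = 1`, which determines `p'`.
  obtain ⟨p, hp, hp'⟩ := exists_antiderivative isOpen_univ ordConnected_univ hg.contDiffOn
  rw [contDiffOn_univ] at hp
  have hpd : ∀ u, HasDerivAt p (√(1 - φ' u ^ 2) / Real.cos (φ u)) u := fun u =>
    hp' u trivial ▸ (hp.differentiable (by simp)).differentiableAt.hasDerivAt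
  have hd0 : ∀ u, deriv (fun u => Real.cos (φ u) * Real.cos (p u)) u =
      -Real.sin (φ u) * φ' u * Real.cos (p u) - √(1 - φ' u ^ 2) * Real.sin (p u) := by
    intro u
    refine ((hφd u).cos.mul (hpd u).cos).deriv.trans ?_
    field_simp [(hcos u).ne']
    ring
  have hd1 : ∀ u, deriv (fun u => Real.cos (φ u) * Real.sin (p u)) u =
      -Real.sin (φ u) * φ' u * Real.sin (p u) + √(1 - φ' u ^ 2) * Real.cos (p u) := by
    intro u
    refine ((hφd u).cos.mul (hpd u).sin).deriv.trans ?_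
    field_simp [(hcos u).ne']
  have hd2 : ∀ u, deriv (fun u => Real.sin (φ u)) u = Real.cos (φ u) * φ' u := fun u =>
    (hφd u).sin.deriv
  -- The curve already lies in a two-dimensional sphere; the zero coordinate pads it to four
  -- coordinates, the number behind the dimensions for embeddings.
  have hγ : IsUnitCurve (fun _ => 1) 1 ![fun u => Real.cos (φ u) * Real.cos (p u),
      fun u => Real.cos (φ u) * Real.sin (p u), fun u => Real.sin (φ u), fun _ => 0] := by
    refine ⟨fun k => ?_, fun u => ?_, fun u => ?_⟩
    · fin_cases k
      exacts [(Real.contDiff_cos.comp hφc).mul (Real.contDiff_cos.comp hp),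
        (Real.contDiff_cos.comp hφc).mul (Real.contDiff_sin.comp hp),
        Real.contDiff_sin.comp hφc, contDiff_const]
    · have h1 := Real.sin_sq_add_cos_sq (φ u)
      have h2 := Real.sin_sq_add_cos_sq (p u)
      simp [Fin.sum_univ_four]
      linear_combination h1 + Real.cos (φ u) ^ 2 * h2
    · have h1 := Real.sin_sq_add_cos_sq (φ u)
      have h2 := Real.sin_sq_add_cos_sq (p u)
      have h3 := Real.sq_sqrt (hφ'1 u).le
      simp only [Fin.sum_univ_four, Matrix.cons_val, hd0, hd1, hd2, deriv_const]
      linear_combination h3 + φ' u ^ 2 * h1 +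
        (Real.sin (φ u) ^ 2 * φ' u ^ 2 + √(1 - φ' u ^ 2) ^ 2) * h2
  refine ⟨_, hγ, isInducing_of_coord (fun k => (hγ.contDiff k).continuous) 2 ?_⟩
  intro u v huv
  refine Real.strictMonoOn_sin ?_ ?_ ?_
  · exact ⟨(hmem u).1.le, (hmem u).2.le⟩
  · exact ⟨(hmem v).1.le, (hmem v).2.le⟩
  · exact div_lt_div_of_pos_right (Real.arctan_strictMono huv) two_pos

end Curves

/-! ### Model maps on `J × ℝ^n` for the three targets -/

section Models

variable {α β : Type*} {J : Set ℝ}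

/-- The functions `Φ k` of `(t, u)` determine, topologically, the point `(t, u)`, where `t ∈ J`. -/
def SeparatesNhds {ι K : Type*} (J : Set ℝ) (Φ : K → ℝ × (ι → ℝ) → ℝ) : Prop :=
  ∀ (𝓕 : Filter (ℝ × (ι → ℝ))) (x : ℝ × (ι → ℝ)), x.1 ∈ J → (∀ᶠ y in 𝓕, y.1 ∈ J) →
    (∀ k, Tendsto (Φ k) 𝓕 (𝓝 (Φ k x))) → 𝓕 ≤ 𝓝 x

/-- The closing block gives `t` first; this convergence is then available when the other two blocks
are used to recover the coordinates. -/
theorem SeparatesNhds.of_blocks {K₁ K₂ K₃ : Type*} {Φ₁ : K₁ → ℝ × (α ⊕ β → ℝ) → ℝ}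
    {Φ₂ : K₂ → ℝ × (α ⊕ β → ℝ) → ℝ} {Φ₃ : K₃ → ℝ × (α ⊕ β → ℝ) → ℝ}
    (h₁ : ∀ (𝓕 : Filter (ℝ × (α ⊕ β → ℝ))) (x : ℝ × (α ⊕ β → ℝ)), x.1 ∈ J →
      Tendsto Prod.fst 𝓕 (𝓝 x.1) → (∀ k, Tendsto (Φ₁ k) 𝓕 (𝓝 (Φ₁ k x))) →
      ∀ j, Tendsto (fun y => y.2 (Sum.inl j)) 𝓕 (𝓝 (x.2 (Sum.inl j))))
    (h₂ : ∀ (𝓕 : Filter (ℝ × (α ⊕ β → ℝ))) (x : ℝ × (α ⊕ β → ℝ)), x.1 ∈ J →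
      Tendsto Prod.fst 𝓕 (𝓝 x.1) → (∀ k, Tendsto (Φ₂ k) 𝓕 (𝓝 (Φ₂ k x))) →
      ∀ j, Tendsto (fun y => y.2 (Sum.inr j)) 𝓕 (𝓝 (x.2 (Sum.inr j))))
    (h₃ : ∀ (𝓕 : Filter (ℝ × (α ⊕ β → ℝ))) (x : ℝ × (α ⊕ β → ℝ)), x.1 ∈ J →
      (∀ᶠ y in 𝓕, y.1 ∈ J) → (∀ k, Tendsto (Φ₃ k) 𝓕 (𝓝 (Φ₃ k x))) →
      Tendsto Prod.fst 𝓕 (𝓝 x.1)) :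
    SeparatesNhds J (Sum.elim (Sum.elim Φ₁ Φ₂) Φ₃) := by
  intro 𝓕 x hx hJ𝓕 h
  have ht := h₃ 𝓕 x hx hJ𝓕 fun k => h (Sum.inr k)
  have hu : Tendsto (fun y : ℝ × (α ⊕ β → ℝ) => y.2) 𝓕 (𝓝 x.2) := by
    rw [tendsto_pi_nhds]
    rintro (j | j)
    · exact h₁ 𝓕 x hx ht (fun k => h (Sum.inl (Sum.inl k))) j
    · exact h₂ 𝓕 x hx ht (fun k => h (Sum.inl (Sum.inr k))) j
  exact ht.prodMk_nhds hu

/-- The block `η(t) (cosh u, sinh u)` at each of the coordinates `Sum.inl j`. -/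
noncomputable def hyperbolicBlock (η : α ⊕ β → ℝ → ℝ) (k : α × (Unit ⊕ Unit)) (x : ℝ × (α ⊕ β → ℝ)) : ℝ :=
  η (Sum.inl k.1) x.1 * hyperbola k.2 (1 * x.2 (Sum.inl k.1))

/-- The block `η(t) (cosh u, sinh u, 1)` at each of the coordinates `Sum.inl j`. -/
noncomputable def horosphericalBlock (η : α ⊕ β → ℝ → ℝ) (k : α × ((Unit ⊕ Unit) ⊕ Unit))
    (x : ℝ × (α ⊕ β → ℝ)) : ℝ :=
  (Sum.elim (fun l x => η (Sum.inl k.1) x.1 * hyperbola l (1 * x.2 (Sum.inl k.1)))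
    (fun _ x => η (Sum.inl k.1) x.1) : _ → ℝ × (α ⊕ β → ℝ) → ℝ) k.2 x

variable {η : α ⊕ β → ℝ → ℝ}

theorem tendsto_coord_of_hyperbolicBlock (hJ : IsOpen J) (hη : ∀ j, ContDiffOn ℝ ∞ (η j) J)
    (hη0 : ∀ j, ∀ t ∈ J, 0 < η j t) (𝓕 : Filter (ℝ × (α ⊕ β → ℝ))) (x : ℝ × (α ⊕ β → ℝ))
    (hx : x.1 ∈ J) (ht : Tendsto Prod.fst 𝓕 (𝓝 x.1))
    (h : ∀ k, Tendsto (hyperbolicBlock η k) 𝓕 (𝓝 (hyperbolicBlock η k x))) (j : α) :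
    Tendsto (fun y => y.2 (Sum.inl j)) 𝓕 (𝓝 (x.2 (Sum.inl j))) := by
  have h1 := tendsto_angle_of_mul_curve isInducing_hyperbola
    (((hη (Sum.inl j)).continuousOn.continuousAt (hJ.mem_nhds hx)).tendsto.comp ht)
    (hη0 (Sum.inl j) _ hx).ne' (r := fun y : ℝ × (α ⊕ β → ℝ) => η (Sum.inl j) y.1) (θ := fun y : ℝ × (α ⊕ β → ℝ) => 1 * y.2 (Sum.inl j))
    (θ₀ := 1 * x.2 (Sum.inl j)) fun k => h (j, k)
  simpa only [one_mul] using h1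

theorem tendsto_coord_of_horosphericalBlock (hJ : IsOpen J) (hη : ∀ j, ContDiffOn ℝ ∞ (η j) J)
    (hη0 : ∀ j, ∀ t ∈ J, 0 < η j t) (𝓕 : Filter (ℝ × (α ⊕ β → ℝ))) (x : ℝ × (α ⊕ β → ℝ))
    (hx : x.1 ∈ J) (ht : Tendsto Prod.fst 𝓕 (𝓝 x.1))
    (h : ∀ k, Tendsto (horosphericalBlock η k) 𝓕 (𝓝 (horosphericalBlock η k x))) (j : α) :
    Tendsto (fun y => y.2 (Sum.inl j)) 𝓕 (𝓝 (x.2 (Sum.inl j))) :=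
  tendsto_coord_of_hyperbolicBlock hJ hη hη0 𝓕 x hx ht (fun k => h (k.1, Sum.inl k.2)) j

variable [Fintype α] [Fintype β] [DecidableEq α] [DecidableEq β]

theorem sum_single_inl_add_sum_single_inr (f : α ⊕ β → ℝ → ℝ) (i : α ⊕ β) (t : ℝ) :
    ∑ j, Pi.single (M := fun _ => ℝ → ℝ) (Sum.inl j) (f (Sum.inl j)) i t +
      ∑ j, Pi.single (M := fun _ => ℝ → ℝ) (Sum.inr j) (f (Sum.inr j)) i t = f i t := by
  have h := Fintype.sum_sum_type
    fun j : α ⊕ β => Pi.single (M := fun _ => ℝ → ℝ) j (f j) i t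
  rw [← h, Finset.sum_eq_single i]
  · simp
  · intro j _ hj
    simp [Pi.single_eq_of_ne hj.symm]
  · simp

theorem isWarpedBlock_hyperbola_coord (hJ : IsOpen J) (hη : ∀ j, ContDiffOn ℝ ∞ (η j) J) (j : α) :
    IsWarpedBlock J lorentzSign
      (fun k (x : ℝ × (α ⊕ β → ℝ)) => η (Sum.inl j) x.1 * hyperbola k (1 * x.2 (Sum.inl j)))
      (fun t => -1 * deriv (η (Sum.inl j)) t ^ 2) (fun t => -1 * η (Sum.inl j) t ^ 2)
      (Pi.single (Sum.inl j) fun t => (η (Sum.inl j) t * 1) ^ 2) :=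
  isUnitCurve_hyperbola.isWarpedBlock_coord hJ (hη _) (μ := fun _ => 1)
    (fun _ _ => ⟨1, rfl, Eventually.of_forall fun _ _ => rfl⟩) (Sum.inl j)

theorem isWarpedBlock_hyperbolicBlock (hJ : IsOpen J) (hη : ∀ j, ContDiffOn ℝ ∞ (η j) J) :
    IsWarpedBlock J (fun k : α × (Unit ⊕ Unit) => lorentzSign k.2) (hyperbolicBlock η)
      (fun t => -∑ j, deriv (η (Sum.inl j)) t ^ 2) (fun t => -∑ j, η (Sum.inl j) t ^ 2)
      (fun i t => ∑ j, Pi.single (M := fun _ => ℝ → ℝ) (Sum.inl j)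
        (fun t => η (Sum.inl j) t ^ 2) i t) :=
  (IsWarpedBlock.family (isWarpedBlock_hyperbola_coord hJ hη)).congr (fun _ _ => by simp)
    (fun _ _ => by simp) fun _ _ _ => by simp

/-- The added spacelike coordinate `η` contributes `η'² dt²` and `η²`, which cancel the negative
terms of the hyperbola. -/
theorem isWarpedBlock_horosphericalBlock (hJ : IsOpen J) (hη : ∀ j, ContDiffOn ℝ ∞ (η j) J) :
    IsWarpedBlock J (fun k : α × ((Unit ⊕ Unit) ⊕ Unit) =>
      Sum.elim lorentzSign (fun _ => (1 : ℝ)) k.2) (horosphericalBlock η)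
      (fun _ => 0) (fun _ => 0)
      (fun i t => ∑ j, Pi.single (M := fun _ => ℝ → ℝ) (Sum.inl j)
        (fun t => η (Sum.inl j) t ^ 2) i t) :=
  (IsWarpedBlock.family fun j => (isWarpedBlock_hyperbola_coord hJ hη j).sum
    (isWarpedBlock_single hJ (hη (Sum.inl j)) 1)).congr (fun _ _ => by simp)
    (fun _ _ => by simp) fun _ _ _ => by simp

variable {K : Type*} [Fintype K] {γ : K → ℝ → ℝ} {ρ : ℝ → ℝ}

/-- The signs of the model map of a warped product to a semi-Euclidean space. -/
def flatSign (α β K : Type*) : (α × (Unit ⊕ Unit) ⊕ β × Bool × K) ⊕ Unit → ℝ :=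
  Sum.elim (Sum.elim (fun k => lorentzSign k.2) fun _ => 1) fun _ => 1

/-- The signs of the model map of a warped product to a pseudosphere. -/
def sphereSign (α β K : Type*) : (α × (Unit ⊕ Unit) ⊕ β × Bool × K) ⊕ K → ℝ :=
  Sum.elim (Sum.elim (fun k => lorentzSign k.2) fun _ => 1) fun _ => 1

/-- The signs of the model map of a warped product to a pseudohyperbolic space. -/
def hyperbolicSign (α β K : Type*) :
    (α × ((Unit ⊕ Unit) ⊕ Unit) ⊕ β × Bool × K) ⊕ (Unit ⊕ Unit) → ℝ :=
  Sum.elim (Sum.elim (fun k => Sum.elim lorentzSign (fun _ => 1) k.2) fun _ => 1) lorentzSign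

/-- The hyperbolic blocks only lower the coefficient of `dt²`, and the small block adds at most `ρ²
/ 2`, so there is room for a closing function. -/
theorem exists_flat_model (hγ : IsUnitCurve (fun _ => 1) 1 γ) (hJ : IsOpen J)
    (hJ' : J.OrdConnected) (hη : ∀ j, ContDiffOn ℝ ∞ (η j) J) (hη0 : ∀ j, ∀ t ∈ J, 0 < η j t)
    (hρ : ContDiffOn ℝ ∞ ρ J) (hρ0 : ∀ t ∈ J, 0 < ρ t) :
    ∃ Φ s, IsWarpedBlock J (flatSign α β K) Φ (fun t => ρ t ^ 2) s (fun j t => η j t ^ 2) ∧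
      ((IsInducing fun θ k => γ k θ) → SeparatesNhds J Φ) := by
  obtain ⟨Φ, h, s, hΦ, hh, -, -, hsep⟩ := hγ.exists_block_small hJ hJ'
    (fun j => hη (Sum.inr j)) (fun j => hη0 (Sum.inr j)) (ε := fun t => ρ t ^ 2 / 2)
    ((hρ.continuousOn.pow 2).div_const 2) (fun t ht => half_pos (pow_pos (hρ0 t ht) 2))
    (Sum.inr : β → α ⊕ β)
  have hblock := (isWarpedBlock_hyperbolicBlock hJ hη).sum hΦ
  obtain ⟨Ψ, h', s', hΨ, hh', hsep'⟩ := exists_closing_block_single (ι := α ⊕ β) hJ hJ'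
    hblock.contDiffOn_h hρ (fun t ht => by
      have h1 := (hh t ht).2
      have h2 := pow_pos (hρ0 t ht) 2
      have h3 : 0 ≤ ∑ j : α, deriv (η (Sum.inl j)) t ^ 2 :=
        Finset.sum_nonneg fun j _ => sq_nonneg _
      linarith)
  refine ⟨_, _, (hblock.sum hΨ).congr (fun t ht => (hh' t ht).symm) (fun t ht => rfl)
    fun t ht i => ?_, fun hind => SeparatesNhds.of_blocks
      (tendsto_coord_of_hyperbolicBlock hJ hη hη0) (hsep hind) hsep'⟩
  rw [add_zero]
  exact (sum_single_inl_add_sum_single_inr (fun j t => η j t ^ 2) i t).symm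

/-- Without the small block the closing inequality reads `B² < (ρ² + Q)(C + P)`. By Cauchy–Schwarz
`B² ≤ P Q`, which leaves a margin of at least `C ρ²` to absorb the errors. -/
theorem exists_sphere_model (hγ : IsUnitCurve (fun _ => 1) 1 γ) (hJ : IsOpen J)
    (hJ' : J.OrdConnected) (hη : ∀ j, ContDiffOn ℝ ∞ (η j) J) (hη0 : ∀ j, ∀ t ∈ J, 0 < η j t)
    (hρ : ContDiffOn ℝ ∞ ρ J) (hρ0 : ∀ t ∈ J, 0 < ρ t) {C : ℝ} (hC : 0 < C) :
    ∃ Φ, IsWarpedBlock J (sphereSign α β K) Φ (fun t => ρ t ^ 2) (fun _ => C)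
        (fun j t => η j t ^ 2) ∧
      ((IsInducing fun θ k => γ k θ) → SeparatesNhds J Φ) := by
  have hneg := isWarpedBlock_hyperbolicBlock (α := α) (β := β) hJ hη
  set P : ℝ → ℝ := fun t => ∑ j : α, η (Sum.inl j) t ^ 2 with hP
  set Q : ℝ → ℝ := fun t => ∑ j : α, deriv (η (Sum.inl j)) t ^ 2 with hQ
  set B : ℝ → ℝ := fun t => ∑ j : α, η (Sum.inl j) t * deriv (η (Sum.inl j)) t with hB
  have hP0 : ∀ t, 0 ≤ P t := fun t => Finset.sum_nonneg fun j _ => sq_nonneg _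
  have hQ0 : ∀ t, 0 ≤ Q t := fun t => Finset.sum_nonneg fun j _ => sq_nonneg _
  have hBPQ : ∀ t, B t ^ 2 ≤ P t * Q t := fun t => Finset.sum_mul_sq_le_sq_mul_sq _ _ _
  have hPc : ContinuousOn P J := continuousOn_finsetSum _ fun j _ => (hη _).continuousOn.pow 2
  have hQc : ContinuousOn Q J := continuousOn_finsetSum _ fun j _ =>
    (contDiffOn_deriv_of_isOpen hJ (hη _)).continuousOn.pow 2
  have hBc : ContinuousOn B J := continuousOn_finsetSum _ fun j _ =>
    (hη _).continuousOn.mul (contDiffOn_deriv_of_isOpen hJ (hη _)).continuousOn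
  -- `D` bounds the sum of the coefficients of the error terms in the closing inequality, so errors
  -- of size `C ρ² / D` fit into the margin `C ρ²`. The bound `1` on the error controls `s'²`, and
  -- `C / 2` keeps the radius positive.
  set D : ℝ → ℝ := fun t => (C + P t) + (ρ t ^ 2 + Q t) + |B t| + 1 with hD
  have hD0 : ∀ t, 0 < D t := fun t => by
    have := hP0 t
    have := hQ0 t
    positivity
  obtain ⟨Φ, h, s, hΦ, hh, hs, hs', hsep⟩ := hγ.exists_block_small hJ hJ'
    (fun j => hη (Sum.inr j)) (fun j => hη0 (Sum.inr j))
    (ε := fun t => min (min 1 (C / 2)) (C * ρ t ^ 2 / D t))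
    (continuousOn_const.inf ((continuousOn_const.mul (hρ.continuousOn.pow 2)).div
      ((((continuousOn_const.add hPc).add ((hρ.continuousOn.pow 2).add hQc)).add hBc.abs).add
        continuousOn_const) fun t _ => (hD0 t).ne'))
    (fun t ht => lt_min (lt_min one_pos (half_pos hC))
      (div_pos (mul_pos hC (pow_pos (hρ0 t ht) 2)) (hD0 t))) (Sum.inr : β → α ⊕ β)
  have hblock := hneg.sum hΦ
  have hderiv : ∀ t ∈ J, deriv (fun t => -P t + s t) t = -2 * B t + deriv s t := by
    intro t ht
    have h1 : HasDerivAt P (2 * B t) t := by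
      refine (HasDerivAt.fun_sum fun j _ =>
        (hasDerivAt_of_contDiffOn hJ (hη (Sum.inl j)) ht).pow 2).congr_deriv ?_
      rw [hB, Finset.mul_sum]
      refine Finset.sum_congr rfl fun j _ => ?_
      simp
      ring
    refine (h1.neg.add (hasDerivAt_of_contDiffOn hJ hΦ.contDiffOn_s ht)).deriv.trans ?_
    ring
  obtain ⟨Ψ, h', s', hΨ, hh', hss', -, hsep'⟩ := hγ.exists_closing_block (ι := α ⊕ β) hJ hJ'
    hblock.contDiffOn_h hblock.contDiffOn_s hρ (C := C) (one_mul 1) (fun t ht => by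
      have h1 := (hs t ht).2.trans ((min_le_left _ _).trans (min_le_right _ _))
      have h2 := hP0 t
      linarith) (fun t ht => by
      rw [hderiv t ht]
      obtain ⟨hh1, hh2⟩ := hh t ht
      obtain ⟨hs1, hs2⟩ := hs t ht
      have hs3 := hs' t ht
      set e := min (min 1 (C / 2)) (C * ρ t ^ 2 / D t) with he
      have he1 : e ≤ 1 := (min_le_left _ _).trans (min_le_left _ _)
      have heD : e * D t ≤ C * ρ t ^ 2 := (le_div_iff₀ (hD0 t)).1 (min_le_right _ _)
      have he0 : 0 < e := lt_min (lt_min one_pos (half_pos hC))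
        (div_pos (mul_pos hC (pow_pos (hρ0 t ht) 2)) (hD0 t))
      have hρ2 := pow_pos (hρ0 t ht) 2
      have h1 : (C + P t) * h t ≤ (C + P t) * e :=
        mul_le_mul_of_nonneg_left hh2 (add_nonneg hC.le (hP0 t))
      have h2 : (ρ t ^ 2 + Q t) * s t ≤ (ρ t ^ 2 + Q t) * e :=
        mul_le_mul_of_nonneg_left hs2 (add_nonneg hρ2.le (hQ0 t))
      have h3 : 0 ≤ h t * s t := mul_nonneg hh1 hs1
      have h4 : -(B t * deriv s t) ≤ |B t| * e := by
        refine (neg_le_abs _).trans ?_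
        rw [abs_mul]
        exact mul_le_mul_of_nonneg_left hs3 (abs_nonneg _)
      have h5 : deriv s t ^ 2 ≤ e := by
        rw [← sq_abs]
        nlinarith [abs_nonneg (deriv s t)]
      have h6 := hBPQ t
      have h7 : 0 ≤ C * Q t := mul_nonneg hC.le (hQ0 t)
      have h8 : 0 ≤ P t * ρ t ^ 2 := mul_nonneg (hP0 t) hρ2.le
      have h9 : e * D t = (C + P t) * e + (ρ t ^ 2 + Q t) * e + |B t| * e + e := by
        rw [hD]
        ring
      nlinarith)
  refine ⟨_, (hblock.sum hΨ).congr (fun t ht => (hh' t ht).symm)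
    (fun t ht => ((hss' t ht).trans (one_mul C)).symm)
    fun t ht i => ?_, fun hind => SeparatesNhds.of_blocks
      (tendsto_coord_of_hyperbolicBlock hJ hη hη0) (hsep hind) (hsep' hind)⟩
  rw [add_zero]
  exact (sum_single_inl_add_sum_single_inr (fun j t => η j t ^ 2) i t).symm

/-- The horospherical blocks contribute nothing to `h` and `s`. With `σ = -1` the term in `s'²` has
the favourable sign, so no bound on `s'` is needed; the timelike closing coordinate is `r cosh Θ >
0`. -/
theorem exists_hyperbolic_model (hγ : IsUnitCurve (fun _ => 1) 1 γ) (hJ : IsOpen J)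
    (hJ' : J.OrdConnected) (hη : ∀ j, ContDiffOn ℝ ∞ (η j) J) (hη0 : ∀ j, ∀ t ∈ J, 0 < η j t)
    (hρ : ContDiffOn ℝ ∞ ρ J) (hρ0 : ∀ t ∈ J, 0 < ρ t) {C : ℝ} (hC : 0 < C) :
    ∃ Φ, IsWarpedBlock J (hyperbolicSign α β K) Φ (fun t => ρ t ^ 2) (fun _ => -C)
        (fun j t => η j t ^ 2) ∧
      (∀ x : ℝ × (α ⊕ β → ℝ), x.1 ∈ J → 0 < Φ (Sum.inr (Sum.inl ())) x) ∧
      ((IsInducing fun θ k => γ k θ) → SeparatesNhds J Φ) := by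
  obtain ⟨Φ, h, s, hΦ, hh, hs, -, hsep⟩ := hγ.exists_block_small hJ hJ'
    (fun j => hη (Sum.inr j)) (fun j => hη0 (Sum.inr j)) (ε := fun t => ρ t ^ 2 / 2)
    ((hρ.continuousOn.pow 2).div_const 2) (fun t ht => half_pos (pow_pos (hρ0 t ht) 2))
    (Sum.inr : β → α ⊕ β)
  have hblock := (isWarpedBlock_horosphericalBlock hJ hη).sum hΦ
  obtain ⟨Ψ, h', s', hΨ, hh', hss', ⟨r, Θ, hr, hrΘ⟩, hsep'⟩ :=
    isUnitCurve_hyperbola.exists_closing_block (ι := α ⊕ β) hJ hJ'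
    hblock.contDiffOn_h hblock.contDiffOn_s hρ (C := C) (by norm_num) (fun t ht => by
      have h1 := (hs t ht).1
      linarith) (fun t ht => by
      have h1 := (hh t ht).2
      have h2 := pow_pos (hρ0 t ht) 2
      have h3 := (hs t ht).1
      have h4 : 0 < (ρ t ^ 2 - (0 + h t)) * (C - -1 * (0 + s t)) :=
        mul_pos (by linarith) (by linarith)
      have h5 := sq_nonneg (deriv (fun t => 0 + s t) t)
      linarith)
  refine ⟨_, (hblock.sum hΨ).congr (fun t ht => (hh' t ht).symm)
    (fun t ht => ((hss' t ht).trans (neg_one_mul C)).symm)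
    fun t ht i => ?_, fun x hx => ?_, fun hind => SeparatesNhds.of_blocks
      (tendsto_coord_of_horosphericalBlock hJ hη hη0) (hsep hind) (hsep' isInducing_hyperbola)⟩
  · rw [add_zero]
    exact (sum_single_inl_add_sum_single_inr (fun j t => η j t ^ 2) i t).symm
  · rw [hrΘ]
    exact mul_pos (hr _ hx) (Real.cosh_pos _)

end Models

/-! ### Ordering the coordinates by sign -/

/-- The sum of the signs is `N` minus twice the number of negative ones, so it determines that
number; the negative indices are then placed first. -/
theorem exists_equiv_fin_of_sign {K : Type*} [Fintype K] {ε : K → ℝ}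
    (hε : ∀ k, ε k = 1 ∨ ε k = -1) {N a : ℕ} (hN : Fintype.card K = N)
    (ha : ∑ k, ε k = N - 2 * a) :
    ∃ e : K ≃ Fin N, ∀ k, ε k = if (e k).val < a then -1 else 1 := by
  classical
  have hε' : ∀ k, ε k = 1 - 2 * if ε k = -1 then (1 : ℝ) else 0 := by
    intro k
    rcases hε k with h | h
    · rw [h]
      norm_num
    · rw [h]
      norm_num
  have hcard : Fintype.card {k // ε k = -1} = a := by
    have h1 : ∑ k, ε k = N - 2 * (Fintype.card {k // ε k = -1} : ℝ) := by
      rw [Finset.sum_congr rfl fun k _ => hε' k, Finset.sum_sub_distrib, ← Finset.mul_sum,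
        Fintype.card_subtype]
      simp [hN]
    have h2 : (Fintype.card {k // ε k = -1} : ℝ) = a := by linarith
    exact_mod_cast h2
  have haN : a ≤ N := by
    rw [← hcard, ← hN]
    exact Fintype.card_subtype_le _
  have hcard' : Fintype.card {i : Fin N // i.val < a} = a := by
    rw [Fintype.card_subtype, Fin.card_filter_val_lt, min_eq_right haN]
  have e₁ : {k // ε k = -1} ≃ {i : Fin N // i.val < a} :=
    Fintype.equivOfCardEq (hcard.trans hcard'.symm)
  have e₂ : {k // ¬ ε k = -1} ≃ {i : Fin N // ¬ i.val < a} := by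
    refine Fintype.equivOfCardEq ?_
    rw [Fintype.card_subtype_compl, Fintype.card_subtype_compl, hcard, hcard', hN, Fintype.card_fin]
  refine ⟨(Equiv.sumCompl fun k => ε k = -1).symm.trans
    ((Equiv.sumCongr e₁ e₂).trans (Equiv.sumCompl fun i : Fin N => i.val < a)), fun k => ?_⟩
  by_cases hk : ε k = -1
  · rw [Equiv.trans_apply, Equiv.trans_apply,
      Equiv.sumCompl_symm_apply_of_pos (p := fun k => ε k = -1) hk, hk]
    simp [(e₁ ⟨k, hk⟩).2]
  · rw [Equiv.trans_apply, Equiv.trans_apply,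
      Equiv.sumCompl_symm_apply_of_neg (p := fun k => ε k = -1) hk, (hε k).resolve_right hk]
    simp [(e₂ ⟨k, hk⟩).2]

/-! ### From model maps to maps of the warped product -/

section Manifold

variable {k : ℕ} {m d : Fin k → ℕ} {M : Fin k → Type*} [∀ l, TopologicalSpace (M l)]
  [∀ l, ChartedSpace (EuclideanSpace ℝ (Fin (m l))) (M l)] {J : TopologicalSpace.Opens ℝ}

theorem contMDiff_warpedProj (l : Fin k) :
    ContMDiff (warpedModel m) (𝓡 (m l)) ∞ (fun x : J × ∀ l, M l => x.2 l) := by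
  intro p
  rw [contMDiffAt_iff]
  refine ⟨by fun_prop, ?_⟩
  have key : ∀ z ∈ (extChartAt (warpedModel m) p).target,
      (extChartAt (𝓡 (m l)) (p.2 l) ∘ (fun x : J × ∀ l, M l => x.2 l) ∘
        (extChartAt (warpedModel m) p).symm) z = warpedProjL m l z := by
    intro z hz
    have h2 : z.2 l ∈ (extChartAt (𝓡 (m l)) (p.2 l)).target := by
      simp only [extChartAt_prod, PartialEquiv.prod_target] at hz
      have h3 := hz.2
      simp [extChartAt, ModelWithCorners.pi, piChartedSpace_chartAt] at h3
      simp [extChartAt]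
      exact h3 l trivial
    exact (extChartAt (𝓡 (m l)) (p.2 l)).right_inv h2
  refine (warpedProjL m l).contDiff.contDiffWithinAt.congr_of_eventuallyEq ?_ ?_
  · filter_upwards [extChartAt_target_mem_nhdsWithin (I := warpedModel m) p] with z hz
    exact key z hz
  · exact key _ (mem_extChartAt_target p)

theorem contMDiff_warpedTime :
    ContMDiff (warpedModel m) 𝓘(ℝ, ℝ) ∞ (fun x : J × ∀ l, M l => (x.1 : ℝ)) :=
  contMDiff_subtype_val.comp contMDiff_fst

variable {ι : Type*} [Fintype ι]

/-- The map `(t, p) ↦ (t, f(p))`, with the coordinates of all the maps `f l` indexed by `ι`. -/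
def warpedCoord (f : ∀ l, M l → EuclideanSpace ℝ (Fin (d l))) (σ : ι ≃ Σ l, Fin (d l))
    (p : J × ∀ l, M l) : ℝ × (ι → ℝ) :=
  (p.1, fun i => f (σ i).1 (p.2 (σ i).1) (σ i).2)

variable {f : ∀ l, M l → EuclideanSpace ℝ (Fin (d l))} {σ : ι ≃ Σ l, Fin (d l)}

theorem contMDiff_warpedCoord (hf : ∀ l, ContMDiff (𝓡 (m l)) (𝓡 (d l)) ∞ (f l)) :
    ContMDiff (warpedModel m) 𝓘(ℝ, ℝ × (ι → ℝ)) ∞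
      (warpedCoord f σ : (J × ∀ l, M l) → ℝ × (ι → ℝ)) := by
  refine contMDiff_warpedTime.prodMk_space (contMDiff_pi_space.2 fun i => ?_)
  exact (EuclideanSpace.proj (𝕜 := ℝ) (σ i).2).contMDiff.comp
    ((hf (σ i).1).comp (contMDiff_warpedProj (σ i).1))

theorem mfderiv_warpedCoord_fst (hf : ∀ l, ContMDiff (𝓡 (m l)) (𝓡 (d l)) ∞ (f l))
    {p : J × ∀ l, M l} {v : TangentSpace (warpedModel m) p} {x : ℝ × (ι → ℝ)}
    (hx : mfderiv (warpedModel m) 𝓘(ℝ, ℝ × (ι → ℝ)) (warpedCoord f σ) p v = x) :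
    x.1 = warpedDt p v := by
  have h1 := ((contMDiff_warpedCoord (J := J) (σ := σ) hf).mdifferentiable (by simp) p).hasMFDerivAt
  have h2 := ((ContinuousLinearMap.fst ℝ ℝ (ι → ℝ)).hasFDerivAt
    (x := warpedCoord f σ p)).hasMFDerivAt.comp p h1
  exact (congrArg Prod.fst hx.symm).trans (DFunLike.congr_fun h2.mfderiv v).symm

theorem mfderiv_warpedCoord_snd (hf : ∀ l, ContMDiff (𝓡 (m l)) (𝓡 (d l)) ∞ (f l))
    {p : J × ∀ l, M l} {v : TangentSpace (warpedModel m) p} {x : ℝ × (ι → ℝ)}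
    (hx : mfderiv (warpedModel m) 𝓘(ℝ, ℝ × (ι → ℝ)) (warpedCoord f σ) p v = x) (i : ι)
    {y : EuclideanSpace ℝ (Fin (d (σ i).1))}
    (hy : mfderiv (𝓡 (m (σ i).1)) (𝓡 (d (σ i).1)) (f (σ i).1) (p.2 (σ i).1)
        (warpedDproj (σ i).1 p v) = y) :
    x.2 i = y (σ i).2 := by
  have h1 := ((contMDiff_warpedCoord (J := J) (σ := σ) hf).mdifferentiable (by simp) p).hasMFDerivAt
  have h2 := (((ContinuousLinearMap.proj (R := ℝ) (φ := fun _ : ι => ℝ) i).comp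
    (ContinuousLinearMap.snd ℝ ℝ (ι → ℝ))).hasFDerivAt
    (x := warpedCoord f σ p)).hasMFDerivAt.comp p h1
  have h3 := ((hf (σ i).1).mdifferentiable (by simp) (p.2 (σ i).1)).hasMFDerivAt
  have h4 := (contMDiff_warpedProj (m := m) (M := M) (J := J) (σ i).1).mdifferentiable
    (by simp) p |>.hasMFDerivAt
  have h5 := ((EuclideanSpace.proj (𝕜 := ℝ) (σ i).2).hasFDerivAt
    (x := f (σ i).1 (p.2 (σ i).1))).hasMFDerivAt.comp p (h3.comp p h4)
  subst hx hy
  exact DFunLike.congr_fun (hasMFDerivAt_unique h2 h5) v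

variable {K : Type*} {N : ℕ}

/-- The map to `ℝ^N` with coordinates the functions `Φ k` of `(t, f(p))`. -/
def warpedMap (f : ∀ l, M l → EuclideanSpace ℝ (Fin (d l))) (σ : ι ≃ Σ l, Fin (d l))
    (e : K ≃ Fin N) (Φ : K → ℝ × (ι → ℝ) → ℝ) (p : J × ∀ l, M l) : EuclideanSpace ℝ (Fin N) :=
  WithLp.toLp 2 fun i => Φ (e.symm i) (warpedCoord f σ p)

variable {e : K ≃ Fin N} {Φ : K → ℝ × (ι → ℝ) → ℝ}

theorem contDiffAt_of_contDiffOn_prod (hΦ : ∀ k, ContDiffOn ℝ ∞ (Φ k) ((J : Set ℝ) ×ˢ univ))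
    {x : ℝ × (ι → ℝ)} (hx : x.1 ∈ J) (k : K) : ContDiffAt ℝ ∞ (Φ k) x :=
  (hΦ k).contDiffAt ((J.isOpen.prod isOpen_univ).mem_nhds ⟨hx, trivial⟩)

theorem contMDiff_warpedMap (hf : ∀ l, ContMDiff (𝓡 (m l)) (𝓡 (d l)) ∞ (f l))
    (hΦ : ∀ k, ContDiffOn ℝ ∞ (Φ k) ((J : Set ℝ) ×ˢ univ)) :
    ContMDiff (warpedModel m) (𝓡 N) ∞
      (warpedMap f σ e Φ : (J × ∀ l, M l) → EuclideanSpace ℝ (Fin N)) := by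
  intro p
  have h1 : ContDiffAt ℝ ∞ (fun x => (WithLp.toLp 2 fun i => Φ (e.symm i) x :
      EuclideanSpace ℝ (Fin N))) (warpedCoord f σ p) :=
    contDiffAt_euclidean.2 fun i => contDiffAt_of_contDiffOn_prod hΦ p.1.2 (e.symm i)
  exact h1.contMDiffAt.comp p (contMDiff_warpedCoord hf p)

theorem mfderiv_warpedMap (hf : ∀ l, ContMDiff (𝓡 (m l)) (𝓡 (d l)) ∞ (f l))
    (hΦ : ∀ k, ContDiffOn ℝ ∞ (Φ k) ((J : Set ℝ) ×ˢ univ)) {p : J × ∀ l, M l}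
    {v : TangentSpace (warpedModel m) p} {x : ℝ × (ι → ℝ)} {y : EuclideanSpace ℝ (Fin N)}
    (hx : mfderiv (warpedModel m) 𝓘(ℝ, ℝ × (ι → ℝ)) (warpedCoord f σ) p v = x)
    (hy : mfderiv (warpedModel m) (𝓡 N) (warpedMap f σ e Φ) p v = y) (i : Fin N) :
    y i = fderiv ℝ (Φ (e.symm i)) (warpedCoord f σ p) x := by
  have h1 := ((contMDiff_warpedMap (J := J) (e := e) (σ := σ) hf hΦ).mdifferentiable
    (by simp) p).hasMFDerivAt
  have h2 := ((EuclideanSpace.proj (𝕜 := ℝ) i).hasFDerivAt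
    (x := warpedMap f σ e Φ p)).hasMFDerivAt.comp p h1
  have h3 := ((contMDiff_warpedCoord (J := J) (σ := σ) hf).mdifferentiable (by simp) p).hasMFDerivAt
  have h4 := ((contDiffAt_of_contDiffOn_prod hΦ (x := warpedCoord f σ p) p.1.2
    (e.symm i)).differentiableAt (by simp)).hasFDerivAt.hasMFDerivAt.comp p h3
  subst hx hy
  exact DFunLike.congr_fun (hasMFDerivAt_unique h2 h4) v

theorem semiInner_reindex [Fintype K] {a : ℕ} {ε : K → ℝ} (he : ∀ k, ε k = if (e k).val < a then -1 else 1)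
    (x y : EuclideanSpace ℝ (Fin N)) :
    semiInner a x y = ∑ k, ε k * (x (e k) * y (e k)) := by
  rw [semiInner, ← e.sum_comp]
  exact Finset.sum_congr rfl fun k _ => by rw [he]

variable [∀ l, IsManifold (𝓡 (m l)) ∞ (M l)]
  {g : ∀ l, Bundle.ContMDiffRiemannianMetric (𝓡 (m l)) ∞ (EuclideanSpace ℝ (Fin (m l)))
      (fun x : M l => TangentSpace (𝓡 (m l)) x)}
  {ρ : ℝ → ℝ} {η : Fin k → ℝ → ℝ}

theorem warpedMetric_self_pos (hρ_pos : ∀ t ∈ J, 0 < ρ t) (hη_pos : ∀ l, ∀ t ∈ J, 0 < η l t)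
    (p : J × ∀ l, M l) (v : TangentSpace (warpedModel m) p) (hv : v ≠ 0) :
    0 < warpedMetric g J ρ η p v v := by
  have hl : ∀ l (w : TangentSpace (𝓡 (m l)) (p.2 l)), 0 ≤ (g l).inner (p.2 l) w w := by
    intro l w
    by_cases hw : w = 0
    · simp [hw]
    · exact ((g l).pos _ _ hw).le
  have h0 : 0 ≤ ∑ l, η l p.1 ^ 2 *
      (g l).inner (p.2 l) (warpedDproj l p v) (warpedDproj l p v) :=
    Finset.sum_nonneg fun l _ => mul_nonneg (sq_nonneg _) (hl l _)
  have hρ2 := pow_pos (hρ_pos p.1 p.1.2) 2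
  unfold warpedMetric
  by_cases h1 : warpedDt p v = 0
  · obtain ⟨l, hl'⟩ : ∃ l, warpedDproj l p v ≠ 0 := by
      by_contra! hall
      refine hv (Prod.ext ?_ (funext fun l => ?_))
      · rw [← warpedDt_eq, h1]
        rfl
      · rw [← warpedDproj_eq, hall]
        rfl
    rw [h1, mul_zero, mul_zero, zero_add]
    exact Finset.sum_pos' (fun l _ => mul_nonneg (sq_nonneg _) (hl l _))
      ⟨l, Finset.mem_univ _, mul_pos (pow_pos (hη_pos l p.1 p.1.2) 2) ((g l).pos _ _ hl')⟩
  · exact add_pos_of_pos_of_nonneg (mul_pos hρ2 (mul_self_pos.2 h1)) h0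

/-- Summing `du_i²` over the coordinates of one factor gives the Euclidean product pulled back by `f
l`, that is, `g l`. -/
theorem isIsometricImmersion_warpedMap [Fintype K]
    (hf : ∀ l, IsIsometricImmersion (𝓡 (m l)) (fun x v w => (g l).inner x v w)
      (fun x y => inner ℝ x y) (f l))
    (hρ_pos : ∀ t ∈ J, 0 < ρ t) (hη_pos : ∀ l, ∀ t ∈ J, 0 < η l t) {a : ℕ} {ε : K → ℝ}
    (he : ∀ k, ε k = if (e k).val < a then -1 else 1) {s : ℝ → ℝ}
    (hΦ : IsWarpedBlock J ε Φ (fun t => ρ t ^ 2) s fun i t => η (σ i).1 t ^ 2) :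
    IsIsometricImmersion (warpedModel m) (warpedMetric g J ρ η) (semiInner a)
      (warpedMap f σ e Φ : (J × ∀ l, M l) → EuclideanSpace ℝ (Fin N)) := by
  have hf' := fun l => (hf l).contMDiff
  have hpull : ∀ (p : J × ∀ l, M l) (v w : TangentSpace (warpedModel m) p),
      semiInner a (mfderiv (warpedModel m) (𝓡 N) (warpedMap f σ e Φ) p v)
        (mfderiv (warpedModel m) (𝓡 N) (warpedMap f σ e Φ) p w) = warpedMetric g J ρ η p v w := by
    intro p v w
    -- The differentials are named as vectors of fixed Euclidean spaces, so that their coordinates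
    -- can be compared.
    have key : ∀ (X Y : EuclideanSpace ℝ (Fin N)) (x y : ℝ × (ι → ℝ))
        (V W : ∀ l, EuclideanSpace ℝ (Fin (d l))),
        mfderiv (warpedModel m) (𝓡 N) (warpedMap f σ e Φ) p v = X →
        mfderiv (warpedModel m) (𝓡 N) (warpedMap f σ e Φ) p w = Y →
        mfderiv (warpedModel m) 𝓘(ℝ, ℝ × (ι → ℝ)) (warpedCoord f σ) p v = x →
        mfderiv (warpedModel m) 𝓘(ℝ, ℝ × (ι → ℝ)) (warpedCoord f σ) p w = y →
        (∀ l, mfderiv (𝓡 (m l)) (𝓡 (d l)) (f l) (p.2 l) (warpedDproj l p v) = V l) →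
        (∀ l, mfderiv (𝓡 (m l)) (𝓡 (d l)) (f l) (p.2 l) (warpedDproj l p w) = W l) →
        semiInner a X Y = warpedMetric g J ρ η p v w := by
      intro X Y x y V W hX hY hx hy hV hW
      rw [semiInner_reindex he]
      simp only [mfderiv_warpedMap hf' hΦ.contDiffOn hx hX,
        mfderiv_warpedMap hf' hΦ.contDiffOn hy hY, Equiv.symm_apply_apply]
      rw [hΦ.pullback _ p.1.2, mfderiv_warpedCoord_fst hf' hx, mfderiv_warpedCoord_fst hf' hy]
      simp only [fun i => mfderiv_warpedCoord_snd hf' hx i (hV _),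
        fun i => mfderiv_warpedCoord_snd hf' hy i (hW _)]
      rw [σ.sum_comp fun i : Σ l, Fin (d l) => η i.1 (warpedCoord f σ p).1 ^ 2 *
        (V i.1 i.2 * W i.1 i.2), Fintype.sum_sigma]
      unfold warpedMetric
      congr 1
      refine Finset.sum_congr rfl fun l _ => ?_
      have h1 : inner ℝ (V l) (W l) =
          (g l).inner (p.2 l) (warpedDproj l p v) (warpedDproj l p w) :=
        (congrArg₂ (fun x y : EuclideanSpace ℝ (Fin (d l)) => inner ℝ x y) (hV l)
          (hW l)).symm.trans ((hf l).pullback_eq _ _ _)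
      simp only []
      rw [← Finset.mul_sum, ← h1, PiLp.inner_apply]
      congr 1
      exact Finset.sum_congr rfl fun j _ => mul_comm _ _
    exact key _ _ _ _ _ _ rfl rfl rfl rfl (fun _ => rfl) fun _ => rfl
  refine ⟨contMDiff_warpedMap hf' hΦ.contDiffOn, fun p => ?_, hpull⟩
  -- The target form may be indefinite, but the pulled-back metric is positive definite, so a vector
  -- in the kernel has length zero and vanishes.
  rw [injective_iff_map_eq_zero]
  intro v hv
  by_contra hne
  have h1 := warpedMetric_self_pos (g := g) hρ_pos hη_pos p v hne
  rw [← hpull] at h1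
  have h2 : semiInner a (mfderiv (warpedModel m) (𝓡 N) (warpedMap f σ e Φ) p v)
      (mfderiv (warpedModel m) (𝓡 N) (warpedMap f σ e Φ) p v) =
      semiInner a (0 : EuclideanSpace ℝ (Fin N)) 0 :=
    congrArg (fun x : EuclideanSpace ℝ (Fin N) => semiInner a x x) hv
  rw [h2] at h1
  simp [semiInner] at h1

theorem semiInner_warpedMap_self {k : ℕ} {d : Fin k → ℕ} {M : Fin k → Type*}
    {J : TopologicalSpace.Opens ℝ} {ι : Type*} [Fintype ι]
    {f : ∀ l, M l → EuclideanSpace ℝ (Fin (d l))} {σ : ι ≃ Σ l, Fin (d l)} {K : Type*} [Fintype K]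
    {N : ℕ} {e : K ≃ Fin N} {Φ : K → ℝ × (ι → ℝ) → ℝ} {a : ℕ} {ε : K → ℝ}
    (he : ∀ k, ε k = if (e k).val < a then -1 else 1) {h s : ℝ → ℝ} {c : ι → ℝ → ℝ}
    (hΦ : IsWarpedBlock (J : Set ℝ) ε Φ h s c) (p : J × ∀ l, M l) :
    semiInner a (warpedMap f σ e Φ p) (warpedMap f σ e Φ p) = s p.1 := by
  rw [semiInner_reindex he]
  refine Eq.trans ?_ (hΦ.norm (warpedCoord f σ p) p.1.2)
  simp [warpedMap]

/-- The filter of preimages of neighbourhoods is pushed to `J × ℝ^n`, where separation makes it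
converge; convergence in each `M l` follows as `f l` is inducing. Injectivity comes for free, the
domain being T0. -/
theorem isEmbedding_warpedMap {k : ℕ} {d : Fin k → ℕ} {M : Fin k → Type*}
    [∀ l, TopologicalSpace (M l)] {J : TopologicalSpace.Opens ℝ} {ι : Type*}
    {f : ∀ l, M l → EuclideanSpace ℝ (Fin (d l))} {σ : ι ≃ Σ l, Fin (d l)} {K : Type*} {N : ℕ}
    {e : K ≃ Fin N} {Φ : K → ℝ × (ι → ℝ) → ℝ} (hf : ∀ l, IsEmbedding (f l))
    (hc : Continuous (warpedMap f σ e Φ : (J × ∀ l, M l) → EuclideanSpace ℝ (Fin N)))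
    (hsep : SeparatesNhds (J : Set ℝ) Φ) :
    IsEmbedding (warpedMap f σ e Φ : (J × ∀ l, M l) → EuclideanSpace ℝ (Fin N)) := by
  have : ∀ l, T0Space (M l) := fun l => (hf l).t0Space
  refine IsInducing.isEmbedding (isInducing_iff_nhds.2 fun p => le_antisymm
    (hc.tendsto p).le_comap ?_)
  set 𝓖 := comap (warpedMap f σ e Φ : (J × ∀ l, M l) → EuclideanSpace ℝ (Fin N))
    (𝓝 (warpedMap f σ e Φ p)) with h𝓖
  have h1 : map (warpedCoord f σ) 𝓖 ≤ 𝓝 (warpedCoord f σ p) := by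
    refine hsep _ _ p.1.2 (eventually_map.2 (Eventually.of_forall fun q => q.1.2)) fun k => ?_
    rw [tendsto_map'_iff]
    have h2 : Tendsto (fun x : EuclideanSpace ℝ (Fin N) => x (e k))
        (𝓝 (warpedMap f σ e Φ p)) (𝓝 (warpedMap f σ e Φ p (e k))) :=
      (EuclideanSpace.proj (𝕜 := ℝ) (e k)).continuous.tendsto _
    have h3 : ∀ q : J × ∀ l, M l, warpedMap f σ e Φ q (e k) = Φ k (warpedCoord f σ q) :=
      fun q => by simp [warpedMap]
    rw [h3 p] at h2
    exact (h2.comp (tendsto_comap (f :=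
      (warpedMap f σ e Φ : (J × ∀ l, M l) → EuclideanSpace ℝ (Fin N))))).congr h3
  have h2 : Tendsto (fun q : J × ∀ l, M l => q.1) 𝓖 (𝓝 p.1) :=
    IsInducing.subtypeVal.tendsto_nhds_iff.2 ((continuous_fst.tendsto _).comp h1)
  have h3 : ∀ l, Tendsto (fun q : J × ∀ l, M l => q.2 l) 𝓖 (𝓝 (p.2 l)) := by
    intro l
    rw [(hf l).isInducing.tendsto_nhds_iff]
    have h4 : Tendsto (fun q : J × ∀ l, M l => fun j => f l (q.2 l) j) 𝓖
        (𝓝 fun j => f l (p.2 l) j) := by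
      have h5 : ∀ z : Σ l, Fin (d l), Tendsto (fun q : J × ∀ l, M l => f z.1 (q.2 z.1) z.2) 𝓖
          (𝓝 (f z.1 (p.2 z.1) z.2)) := by
        intro z
        obtain ⟨i, rfl⟩ := σ.surjective z
        exact (((continuous_apply i).comp continuous_snd).tendsto (warpedCoord f σ p)).comp h1
      exact tendsto_pi_nhds.2 fun j => h5 ⟨l, j⟩
    exact ((PiLp.continuous_toLp 2 fun _ : Fin (d l) => ℝ).tendsto _).comp h4
  exact h2.prodMk_nhds (tendsto_pi_nhds.2 h3)

end Manifold

/-! ### Signatures of the model maps -/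

section Dimensions

variable (α β K : Type*)

theorem lorentzSign_eq (k : Unit ⊕ Unit) : lorentzSign k = 1 ∨ lorentzSign k = -1 := by
  rcases k with k | k <;> simp [lorentzSign]

theorem flatSign_eq (k) : flatSign α β K k = 1 ∨ flatSign α β K k = -1 := by
  rcases k with (k | k) | k
  exacts [lorentzSign_eq k.2, Or.inl rfl, Or.inl rfl]

theorem sphereSign_eq (k) : sphereSign α β K k = 1 ∨ sphereSign α β K k = -1 := by
  rcases k with (k | k) | k
  exacts [lorentzSign_eq k.2, Or.inl rfl, Or.inl rfl]

theorem hyperbolicSign_eq (k) : hyperbolicSign α β K k = 1 ∨ hyperbolicSign α β K k = -1 := by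
  rcases k with (⟨_, k | k⟩ | k) | k
  exacts [lorentzSign_eq k, Or.inl rfl, Or.inl rfl, lorentzSign_eq k]

variable [Fintype α] [Fintype β] [Fintype K]

theorem sum_flatSign : ∑ k, flatSign α β K k =
    2 * Fintype.card β * Fintype.card K + 1 := by
  simp [flatSign, lorentzSign, Fintype.sum_prod_type]
  ring

theorem sum_sphereSign : ∑ k, sphereSign α β K k =
    2 * Fintype.card β * Fintype.card K + Fintype.card K := by
  simp [sphereSign, lorentzSign, Fintype.sum_prod_type]
  ring

theorem sum_hyperbolicSign : ∑ k, hyperbolicSign α β K k =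
    Fintype.card α + 2 * Fintype.card β * Fintype.card K := by
  simp [hyperbolicSign, lorentzSign, Fintype.sum_prod_type]
  ring

end Dimensions

/-! ### Immersions with an arbitrary spherical curve -/

section Immersions

variable {k : ℕ} {m d : Fin k → ℕ} {M : Fin k → Type*} [∀ l, TopologicalSpace (M l)]
  [∀ l, ChartedSpace (EuclideanSpace ℝ (Fin (m l))) (M l)] [∀ l, IsManifold (𝓡 (m l)) ∞ (M l)]
  {g : ∀ l, Bundle.ContMDiffRiemannianMetric (𝓡 (m l)) ∞ (EuclideanSpace ℝ (Fin (m l)))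
      (fun x : M l => TangentSpace (𝓡 (m l)) x)}
  {f : ∀ l, M l → EuclideanSpace ℝ (Fin (d l))} {J : TopologicalSpace.Opens ℝ}
  {ρ : ℝ → ℝ} {η : Fin k → ℝ → ℝ} {K : Type*} [Fintype K] {γ : K → ℝ → ℝ} {a b : ℕ}

/-- The warped product of submanifolds of Euclidean spaces admits an isometric immersion into a
semi-Euclidean space. -/
theorem exists_isIsometricImmersion_flat
    (hf : ∀ l, IsIsometricImmersion (𝓡 (m l)) (fun x v w => (g l).inner x v w)
      (fun x y => inner ℝ x y) (f l)) (hJ : (J : Set ℝ).OrdConnected)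
    (hρ : ContDiffOn ℝ ∞ ρ J) (hρ_pos : ∀ t ∈ J, 0 < ρ t)
    (hη : ∀ l, ContDiffOn ℝ ∞ (η l) J) (hη_pos : ∀ l, ∀ t ∈ J, 0 < η l t)
    (hγ : IsUnitCurve (fun _ => 1) 1 γ) (hab : a + b = ∑ l, d l) {N : ℕ}
    (hN : N = 2 * a + b * (2 * Fintype.card K) + 1) :
    ∃ F : (J × ∀ l, M l) → EuclideanSpace ℝ (Fin N),
      IsIsometricImmersion (warpedModel m) (warpedMetric g J ρ η) (semiInner a) F ∧
      ((IsInducing fun θ k => γ k θ) → (∀ l, IsEmbedding (f l)) → IsEmbedding F) := by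
  -- Any distribution of the `n` coordinates into `a` hyperbolic and `b` small ones will do.
  have σ : Fin a ⊕ Fin b ≃ Σ l, Fin (d l) := Fintype.equivOfCardEq (by simpa using hab)
  obtain ⟨Φ, s, hΦ, hsep⟩ := exists_flat_model hγ J.isOpen hJ (fun i => hη (σ i).1)
    (fun i => hη_pos (σ i).1) hρ hρ_pos
  obtain ⟨e, he⟩ := exists_equiv_fin_of_sign (flatSign_eq (Fin a) (Fin b) K) (N := N) (a := a)
    (by simp [hN]; ring) (by rw [sum_flatSign, hN]; simp; ring)
  have hF := isIsometricImmersion_warpedMap hf hρ_pos hη_pos he hΦ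
  exact ⟨_, hF, fun hind hemb => isEmbedding_warpedMap hemb hF.contMDiff.continuous (hsep hind)⟩

/-- The warped product of submanifolds of Euclidean spaces admits an isometric immersion into a
pseudosphere. -/
theorem exists_isIsometricImmersionInto_pseudoSphere
    (hf : ∀ l, IsIsometricImmersion (𝓡 (m l)) (fun x v w => (g l).inner x v w)
      (fun x y => inner ℝ x y) (f l)) (hJ : (J : Set ℝ).OrdConnected)
    (hρ : ContDiffOn ℝ ∞ ρ J) (hρ_pos : ∀ t ∈ J, 0 < ρ t)
    (hη : ∀ l, ContDiffOn ℝ ∞ (η l) J) (hη_pos : ∀ l, ∀ t ∈ J, 0 < η l t)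
    (hγ : IsUnitCurve (fun _ => 1) 1 γ) (hab : a + b = ∑ l, d l) {N : ℕ}
    (hN : N + 1 = 2 * a + b * (2 * Fintype.card K) + Fintype.card K) {c : ℝ} (hc : 0 < c) :
    ∃ F : (J × ∀ l, M l) → pseudoSphere N a c,
      IsIsometricImmersionInto (warpedModel m) (warpedMetric g J ρ η) (semiInner a) _ F ∧
      ((IsInducing fun θ k => γ k θ) → (∀ l, IsEmbedding (f l)) → IsEmbedding F) := by
  have σ : Fin a ⊕ Fin b ≃ Σ l, Fin (d l) := Fintype.equivOfCardEq (by simpa using hab)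
  obtain ⟨Φ, hΦ, hsep⟩ := exists_sphere_model hγ J.isOpen hJ (fun i => hη (σ i).1)
    (fun i => hη_pos (σ i).1) hρ hρ_pos (one_div_pos.2 hc)
  obtain ⟨e, he⟩ := exists_equiv_fin_of_sign (sphereSign_eq (Fin a) (Fin b) K) (N := N + 1)
    (a := a) (by simp [hN]; ring) (by rw [sum_sphereSign, hN]; simp; ring)
  have hF := isIsometricImmersion_warpedMap hf hρ_pos hη_pos he hΦ
  have hQ : ∀ p : J × ∀ l, M l, warpedMap f σ e Φ p ∈ pseudoSphere N a c := fun p =>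
    (semiInner_warpedMap_self he hΦ p)
  exact ⟨fun p => ⟨_, hQ p⟩, hF, fun hind hemb =>
    (isEmbedding_warpedMap hemb hF.contMDiff.continuous (hsep hind)).codRestrict _ hQ⟩

/-- The warped product of submanifolds of Euclidean spaces admits an isometric immersion into a
pseudohyperbolic space. -/
theorem exists_isIsometricImmersionInto_pseudoHyperbolic
    (hf : ∀ l, IsIsometricImmersion (𝓡 (m l)) (fun x v w => (g l).inner x v w)
      (fun x y => inner ℝ x y) (f l)) (hJ : (J : Set ℝ).OrdConnected)
    (hρ : ContDiffOn ℝ ∞ ρ J) (hρ_pos : ∀ t ∈ J, 0 < ρ t)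
    (hη : ∀ l, ContDiffOn ℝ ∞ (η l) J) (hη_pos : ∀ l, ∀ t ∈ J, 0 < η l t)
    (hγ : IsUnitCurve (fun _ => 1) 1 γ) (hab : a + b = ∑ l, d l) {N : ℕ}
    (hN : N + 1 = 3 * a + b * (2 * Fintype.card K) + 2) {c : ℝ} (hc : 0 < c) :
    ∃ F : (J × ∀ l, M l) → pseudoHyperbolic N a c,
      IsIsometricImmersionInto (warpedModel m) (warpedMetric g J ρ η) (semiInner (a + 1)) _ F ∧
      (a = 0 → ∀ p, 0 < (F p : EuclideanSpace ℝ (Fin (N + 1))) 0) ∧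
      ((IsInducing fun θ k => γ k θ) → (∀ l, IsEmbedding (f l)) → IsEmbedding F) := by
  have σ : Fin a ⊕ Fin b ≃ Σ l, Fin (d l) := Fintype.equivOfCardEq (by simpa using hab)
  obtain ⟨Φ, hΦ, hpos, hsep⟩ := exists_hyperbolic_model hγ J.isOpen hJ (fun i => hη (σ i).1)
    (fun i => hη_pos (σ i).1) hρ hρ_pos (one_div_pos.2 hc)
  obtain ⟨e, he⟩ := exists_equiv_fin_of_sign (hyperbolicSign_eq (Fin a) (Fin b) K) (N := N + 1)
    (a := a + 1) (by simp [hN]; ring) (by rw [sum_hyperbolicSign, hN]; simp; ring)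
  have hF := isIsometricImmersion_warpedMap hf hρ_pos hη_pos he hΦ
  have hQ : ∀ p : J × ∀ l, M l, warpedMap f σ e Φ p ∈ pseudoHyperbolic N a c := fun p =>
    (semiInner_warpedMap_self he hΦ p)
  refine ⟨fun p => ⟨_, hQ p⟩, hF, fun ha p => ?_, fun hind hemb =>
    (isEmbedding_warpedMap hemb hF.contMDiff.continuous (hsep hind)).codRestrict _ hQ⟩
  -- For `a = 0` the only negative index is `0`, so the coordinate `r cosh Θ` is placed there.
  have h0 : e (Sum.inr (Sum.inl ())) = 0 := by
    have h1 := he (Sum.inr (Sum.inl ()))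
    have h2 : hyperbolicSign (Fin a) (Fin b) K (Sum.inr (Sum.inl ())) = -1 := rfl
    rw [h2] at h1
    by_contra h3
    have h4 : ¬ (e (Sum.inr (Sum.inl ()))).val < a + 1 := by
      have := Fin.val_ne_zero_iff.2 h3
      omega
    rw [if_neg h4] at h1
    norm_num at h1
  have h1 := hpos (warpedCoord f σ p) p.1.2
  change 0 < Φ (e.symm 0) (warpedCoord f σ p)
  rwa [← h0, e.symm_apply_apply]

end Immersions

end WarpedImmersions

/-! ### The main theorem -/

theorem mainTheorem4 {k : ℕ} (m d : Fin k → ℕ) (M : Fin k → Type*)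
    [∀ l, TopologicalSpace (M l)]
    [∀ l, ChartedSpace (EuclideanSpace ℝ (Fin (m l))) (M l)]
    [∀ l, IsManifold (𝓡 (m l)) ∞ (M l)]
    (g : ∀ l, Bundle.ContMDiffRiemannianMetric (𝓡 (m l)) ∞ (EuclideanSpace ℝ (Fin (m l)))
      (fun x : M l => TangentSpace (𝓡 (m l)) x))
    (f : ∀ l, M l → EuclideanSpace ℝ (Fin (d l)))
    (hf : ∀ l, IsIsometricImmersion (𝓡 (m l)) (fun x v w => (g l).inner x v w)
      (fun x y => inner ℝ x y) (f l))
    (J : TopologicalSpace.Opens ℝ) (hJ : (J : Set ℝ).OrdConnected)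
    (ρ : ℝ → ℝ) (hρ : ContDiffOn ℝ ∞ ρ J) (hρ_pos : ∀ t ∈ J, 0 < ρ t)
    (η : Fin k → ℝ → ℝ) (hη : ∀ l, ContDiffOn ℝ ∞ (η l) J) (hη_pos : ∀ l, ∀ t ∈ J, 0 < η l t)
    (n : ℕ) (hn : n = ∑ l, d l) (a : ℕ) (ha : a ≤ n) (c : ℝ) (hc : 0 < c) :
    ((∃ F : (J × ∀ l, M l) → EuclideanSpace ℝ (Fin (4 * n + 1 - 2 * a)),
        IsIsometricImmersion (warpedModel m) (warpedMetric g J ρ η) (semiInner a) F) ∧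
      (∃ F : (J × ∀ l, M l) → pseudoSphere (4 * n + 1 - 2 * a) a c,
        IsIsometricImmersionInto (warpedModel m) (warpedMetric g J ρ η) (semiInner a) _ F) ∧
      (∃ F : (J × ∀ l, M l) → pseudoHyperbolic (4 * n + 1 - a) a c,
        IsIsometricImmersionInto (warpedModel m) (warpedMetric g J ρ η) (semiInner (a + 1)) _ F ∧
          (a = 0 → ∀ p, 0 < (F p : EuclideanSpace ℝ (Fin (4 * n + 1 - a + 1))) 0))) ∧
    ((∀ l, Topology.IsEmbedding (f l)) →
      (∃ F : (J × ∀ l, M l) → EuclideanSpace ℝ (Fin (8 * n + 1 - 6 * a)),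
        IsIsometricImmersion (warpedModel m) (warpedMetric g J ρ η) (semiInner a) F ∧
          Topology.IsEmbedding F) ∧
      (∃ F : (J × ∀ l, M l) → pseudoSphere (8 * n + 3 - 6 * a) a c,
        IsIsometricImmersionInto (warpedModel m) (warpedMetric g J ρ η) (semiInner a) _ F ∧
          Topology.IsEmbedding F) ∧
      (∃ F : (J × ∀ l, M l) → pseudoHyperbolic (8 * n + 1 - 5 * a) a c,
        IsIsometricImmersionInto (warpedModel m) (warpedMetric g J ρ η) (semiInner (a + 1)) _ F ∧
          Topology.IsEmbedding F ∧
          (a = 0 → ∀ p, 0 < (F p : EuclideanSpace ℝ (Fin (8 * n + 1 - 5 * a + 1))) 0))) := by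
  have hab : a + (n - a) = ∑ l, d l := by omega
  -- With `b = n - a`, the circle has two coordinates and costs `4 b` dimensions for the small
  -- blocks; the embedded curve has four and costs `8 b`.
  have hγ := isUnitCurve_unitCircleCurve
  obtain ⟨γ, hγ', hind⟩ := exists_isUnitCurve_isInducing
  refine ⟨⟨?_, ?_, ?_⟩, fun hemb => ⟨?_, ?_, ?_⟩⟩
  · obtain ⟨F, hF, -⟩ := exists_isIsometricImmersion_flat hf hJ hρ hρ_pos hη hη_pos hγ hab
      (N := 4 * n + 1 - 2 * a) (by rw [Fintype.card_fin]; omega)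
    exact ⟨F, hF⟩
  · obtain ⟨F, hF, -⟩ := exists_isIsometricImmersionInto_pseudoSphere hf hJ hρ hρ_pos hη hη_pos hγ
      hab (N := 4 * n + 1 - 2 * a) (by rw [Fintype.card_fin]; omega) hc
    exact ⟨F, hF⟩
  · obtain ⟨F, hF, hF0, -⟩ := exists_isIsometricImmersionInto_pseudoHyperbolic hf hJ hρ hρ_pos hη
      hη_pos hγ hab (N := 4 * n + 1 - a) (by rw [Fintype.card_fin]; omega) hc
    exact ⟨F, hF, hF0⟩
  · obtain ⟨F, hF, hF'⟩ := exists_isIsometricImmersion_flat hf hJ hρ hρ_pos hη hη_pos hγ' hab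
      (N := 8 * n + 1 - 6 * a) (by rw [Fintype.card_fin]; omega)
    exact ⟨F, hF, hF' hind hemb⟩
  · obtain ⟨F, hF, hF'⟩ := exists_isIsometricImmersionInto_pseudoSphere hf hJ hρ hρ_pos hη hη_pos
      hγ' hab (N := 8 * n + 3 - 6 * a) (by rw [Fintype.card_fin]; omega) hc
    exact ⟨F, hF, hF' hind hemb⟩
  · obtain ⟨F, hF, hF0, hF'⟩ := exists_isIsometricImmersionInto_pseudoHyperbolic hf hJ hρ hρ_pos hη
      hη_pos hγ' hab (N := 8 * n + 1 - 5 * a) (by rw [Fintype.card_fin]; omega) hc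
    exact ⟨F, hF, hF' hind hemb, hF0⟩
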